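/- Let $\Bbbk$ be a field. For a $\Bbbk$-coalgebra $C$ let $\mathcal M^C$ be the category of right $C$-comodules and $\mathcal M^C_f$ its full subcategory of finite-dimensional comodules. A coalgebra morphism $f\colon C\to D$ induces the corestriction functor $\mathcal M^C\to\mathcal M^D$, $(V,\rho)\mapsto (V,(\mathrm{id}\otimes f)\rho)$. The pseudo-pullback of a family of functors $F_i\colon \mathcal A_i\to\mathcal B$ $(i\in I)$ is the category whose objects are tuples $(a_i\in\mathcal A_i,\ i\in I;\ b\in\mathcal B;\ \varphi_i)$ with isomorphisms $\varphi_i\colon F_ia_i\cong b$, and whose morphisms are families of morphisms $a_i\to a_i'$ together with a morphism $b\to b'$ compatible with the $\varphi_i,\varphi_i'$. Let $(C_i)_{i\in I}$ be a family of $\Bbbk$-coalgebras and let $C=\prod_i C_i$, with projections $\pi_i\colon C\to C_i$, be its product in the category of $\Bbbk$-coalgebras. (1) The functor from $\mathcal M^C$ to the pseudo-pullback of the forgetful functors $\mathcal M^{C_i}\to \mathrm{Vect}_\Bbbk$ whose components are the corestriction functors along the $\pi_i$ and the forgetful functor of $\mathcal M^C$ (with identities as structure isomorphisms) takes values in, and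 is an equivalence onto, the full subcategory of those objects $(V_i;V;\varphi_i\colon V_i\cong V)$ that are locally finite: $V$ has an exhaustive directed filtration by finite-dimensional subspaces $W$ such that $\varphi_i^{-1}(W)$ is a $C_i$-subcomodule of $V_i$ for every $i\in I$. (2) The corresponding functor from $\mathcal M^C_f$ to the pseudo-pullback of the forgetful functors $\mathcal M^{C_i}_f\to\mathrm{Vect}_{\Bbbk,f}$ to finite-dimensional vector spaces is an equivalence of categories. (3) Statements (1) and (2) also hold when the $C_i$ are $\Bbbk$-bialgebras and $C=\prod_i C_i$ is their product in the category of $\Bbbk$-bialgebras, and when the $C_i$ are Hopf algebras over $\Bbbk$ and $C=\prod_iC_i$ is their product in the category of Hopf $\Bbbk$-algebras (comodules being taken over the underlying coalgebras). -/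

import Mathlib

open CategoryTheory CategoryTheory.Limits
open scoped TensorProduct

universe w u v₁ v₂ v₃ u₁ u₂ u₃

noncomputable section

/-! ### Pseudo-pullbacks of families of functors with a common codomain -/

/-- Objects of the pseudo-pullback of a family of functors `F i : A i ⥤ B`: objects `c i` of `A i`
and `c` of `B`, together with isomorphisms `F i (c i) ≅ c` in `B`. -/
structure PseudoPullback {I : Type w} {A : I → Type u₁} [∀ i, Category.{v₁} (A i)]
    {B : Type u₂} [Category.{v₂} B] (F : ∀ i, A i ⥤ B) where
  obj : ∀ i, A i
  base : B
  iso : ∀ i, (F i).obj (obj i) ≅ base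

namespace PseudoPullback

variable {I : Type w} {A : I → Type u₁} [∀ i, Category.{v₁} (A i)]
  {B : Type u₂} [Category.{v₂} B] {F : ∀ i, A i ⥤ B}

/-- Morphisms of the pseudo-pullback: morphisms in each `A i` and in `B`, compatible with the
structure isomorphisms. -/
@[ext]
structure Hom (X Y : PseudoPullback F) where
  app : ∀ i, X.obj i ⟶ Y.obj i
  baseMap : X.base ⟶ Y.base
  w : ∀ i, (F i).map (app i) ≫ (Y.iso i).hom = (X.iso i).hom ≫ baseMap

instance category : Category (PseudoPullback F) where
  Hom X Y := Hom X Y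
  id X := { app := fun i => 𝟙 (X.obj i), baseMap := 𝟙 X.base, w := fun i => by simp }
  comp f g :=
    { app := fun i => f.app i ≫ g.app i
      baseMap := f.baseMap ≫ g.baseMap
      w := fun i => by
        rw [Functor.map_comp, Category.assoc, g.w, ← Category.assoc, f.w, Category.assoc] }
  id_comp _ := Hom.ext (funext fun _ => Category.id_comp _) (Category.id_comp _)
  comp_id _ := Hom.ext (funext fun _ => Category.comp_id _) (Category.comp_id _)
  assoc _ _ _ := Hom.ext (funext fun _ => Category.assoc _ _ _) (Category.assoc _ _ _)

/-- The comparison functor into the pseudo-pullback induced by functors `G i : E ⥤ A i` and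
`K : E ⥤ B` together with natural isomorphisms `G i ⋙ F i ≅ K`. -/
def lift {E : Type u₃} [Category.{v₃} E] (G : ∀ i, E ⥤ A i) (K : E ⥤ B)
    (α : ∀ i, G i ⋙ F i ≅ K) : E ⥤ PseudoPullback F where
  obj X := { obj := fun i => (G i).obj X, base := K.obj X, iso := fun i => (α i).app X }
  map f :=
    { app := fun i => (G i).map f
      baseMap := K.map f
      w := fun i => (α i).hom.naturality f }
  map_id X := Hom.ext (funext fun i => (G i).map_id X) (K.map_id X)
  map_comp f g := Hom.ext (funext fun i => (G i).map_comp f g) (K.map_comp f g)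

end PseudoPullback

/-! ### Comodules -/

variable {k : Type u} [Field k]

/-- Right comodules over a coalgebra `C`: vector spaces `V` with a coassociative and counital
coaction `V → V ⊗ C`. -/
structure ComodCat (C : CoalgCat.{u} k) extends ModuleCat.{u} k where
  coact : carrier →ₗ[k] carrier ⊗[k] C
  coassoc : TensorProduct.assoc k carrier C C ∘ₗ coact.rTensor C ∘ₗ coact =
    (Coalgebra.comul (R := k) (A := C)).lTensor carrier ∘ₗ coact
  counit_coact : TensorProduct.rid k carrier ∘ₗ
    (Coalgebra.counit (R := k) (A := C)).lTensor carrier ∘ₗ coact = LinearMap.id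

namespace ComodCat

/-- Comodule morphisms: linear maps that commute with the coactions. -/
@[ext]
structure Hom {C : CoalgCat.{u} k} (V W : ComodCat C) where
  toLin : V.carrier →ₗ[k] W.carrier
  comm : W.coact ∘ₗ toLin = toLin.rTensor C ∘ₗ V.coact

/-- The category of right `C`-comodules. -/
instance category (C : CoalgCat.{u} k) : Category (ComodCat C) where
  Hom V W := Hom V W
  id V := { toLin := LinearMap.id, comm := by simp }
  comp f g :=
    { toLin := g.toLin ∘ₗ f.toLin
      comm := by
        rw [← LinearMap.comp_assoc, g.comm, LinearMap.comp_assoc, f.comm,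
          ← LinearMap.comp_assoc, LinearMap.rTensor_comp] }

/-- The forgetful functor from comodules to vector spaces. -/
def fgt (C : CoalgCat.{u} k) : ComodCat C ⥤ ModuleCat.{u} k where
  obj V := V.toModuleCat
  map f := ModuleCat.ofHom f.toLin

/-- Coassociativity of a corestricted coaction. -/
theorem corestrict_coassoc {C D V : Type u} [AddCommGroup C] [Module k C] [Coalgebra k C]
    [AddCommGroup D] [Module k D] [Coalgebra k D] [AddCommGroup V] [Module k V]
    (f : C →ₗc[k] D) (ρ : V →ₗ[k] V ⊗[k] C)
    (hρ : TensorProduct.assoc k V C C ∘ₗ ρ.rTensor C ∘ₗ ρ =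
      (Coalgebra.comul (R := k) (A := C)).lTensor V ∘ₗ ρ) :
    TensorProduct.assoc k V D D ∘ₗ ((f : C →ₗ[k] D).lTensor V ∘ₗ ρ).rTensor D ∘ₗ
        ((f : C →ₗ[k] D).lTensor V ∘ₗ ρ) =
      (Coalgebra.comul (R := k) (A := D)).lTensor V ∘ₗ ((f : C →ₗ[k] D).lTensor V ∘ₗ ρ) := by
  have h1 : (TensorProduct.assoc k V D D).toLinearMap ∘ₗ
      ((f : C →ₗ[k] D).lTensor V ∘ₗ ρ).rTensor D ∘ₗ (f : C →ₗ[k] D).lTensor V =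
      (TensorProduct.map (f : C →ₗ[k] D) (f : C →ₗ[k] D)).lTensor V ∘ₗ
        (TensorProduct.assoc k V C C).toLinearMap ∘ₗ ρ.rTensor C := by
    refine TensorProduct.ext' fun v c => ?_
    simp only [LinearMap.comp_apply, LinearMap.lTensor_tmul, LinearMap.rTensor_tmul]
    induction ρ v with
    | zero => simp
    | add x y hx hy => simp only [TensorProduct.add_tmul, map_add, hx, hy]
    | tmul x y => simp
  have h2 : (Coalgebra.comul (R := k) (A := D)) ∘ₗ (f : C →ₗ[k] D) =
      TensorProduct.map (f : C →ₗ[k] D) (f : C →ₗ[k] D) ∘ₗ Coalgebra.comul :=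
    f.map_comp_comul.symm
  have h3 : (Coalgebra.comul (R := k) (A := D)).lTensor V ∘ₗ (f : C →ₗ[k] D).lTensor V =
      (TensorProduct.map (f : C →ₗ[k] D) (f : C →ₗ[k] D)).lTensor V ∘ₗ
        (Coalgebra.comul (R := k) (A := C)).lTensor V := by
    rw [← LinearMap.lTensor_comp, h2, LinearMap.lTensor_comp]
  refine LinearMap.ext fun v => ?_
  exact (LinearMap.congr_fun h1 (ρ v)).trans
    ((congrArg _ (LinearMap.congr_fun hρ v)).trans (LinearMap.congr_fun h3 (ρ v)).symm)

/-- Counitality of a corestricted coaction. -/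
theorem corestrict_counit {C D V : Type u} [AddCommGroup C] [Module k C] [Coalgebra k C]
    [AddCommGroup D] [Module k D] [Coalgebra k D] [AddCommGroup V] [Module k V]
    (f : C →ₗc[k] D) (ρ : V →ₗ[k] V ⊗[k] C)
    (hρ : TensorProduct.rid k V ∘ₗ (Coalgebra.counit (R := k) (A := C)).lTensor V ∘ₗ ρ =
      LinearMap.id) :
    TensorProduct.rid k V ∘ₗ (Coalgebra.counit (R := k) (A := D)).lTensor V ∘ₗ
      ((f : C →ₗ[k] D).lTensor V ∘ₗ ρ) = LinearMap.id := by
  have h : (Coalgebra.counit (R := k) (A := D)) ∘ₗ (f : C →ₗ[k] D) = Coalgebra.counit :=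
    f.counit_comp
  rw [← LinearMap.comp_assoc ρ, ← LinearMap.lTensor_comp, h]
  exact hρ

/-- The corestriction of a comodule along a coalgebra morphism `f : C → D`: a coaction `ρ` is sent
to `(id ⊗ f) ∘ ρ`. -/
def corestrictObj {C D : CoalgCat.{u} k} (f : C ⟶ D) (V : ComodCat C) : ComodCat D where
  toModuleCat := V.toModuleCat
  coact := (f.toCoalgHom : C →ₗ[k] D).lTensor V.carrier ∘ₗ V.coact
  coassoc := corestrict_coassoc f.toCoalgHom V.coact V.coassoc
  counit_coact := corestrict_counit f.toCoalgHom V.coact V.counit_coact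

/-- The corestriction functor along a coalgebra morphism; it does not change the underlying linear
maps of morphisms. -/
def corestrict {C D : CoalgCat.{u} k} (f : C ⟶ D) : ComodCat C ⥤ ComodCat D where
  obj V := corestrictObj f V
  map {V W} g :=
    { toLin := g.toLin
      comm := by
        have h : (f.toCoalgHom : C →ₗ[k] D).lTensor W.carrier ∘ₗ g.toLin.rTensor C =
            g.toLin.rTensor D ∘ₗ (f.toCoalgHom : C →ₗ[k] D).lTensor V.carrier := by
          rw [LinearMap.lTensor_comp_rTensor, LinearMap.rTensor_comp_lTensor]
        refine LinearMap.ext fun v => ?_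
        exact (congrArg _ (LinearMap.congr_fun g.comm v)).trans
          (LinearMap.congr_fun h (V.coact v)) }

/-- A subspace `W` of a comodule `V` is a subcomodule if the coaction maps `W` into (the image in
`V ⊗ C` of) `W ⊗ C`. -/
def IsSubcomodule {C : CoalgCat.{u} k} (V : ComodCat C) (W : Submodule k V.carrier) : Prop :=
  ∀ x ∈ W, V.coact x ∈ LinearMap.range (W.subtype.rTensor C)

/-- The property of a comodule of being finite-dimensional. -/
def isFD (C : CoalgCat.{u} k) : ObjectProperty (ComodCat C) :=
  fun V => Module.Finite k V.carrier

/-- The forgetful functor from finite-dimensional comodules to finite-dimensional spaces. -/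
def fgtFD (C : CoalgCat.{u} k) : (isFD C).FullSubcategory ⥤ FGModuleCat.{u} k :=
  (ModuleCat.isFG k).lift ((isFD C).ι ⋙ fgt C) (fun V => V.property)

/-- The corestriction functor between categories of finite-dimensional comodules. -/
def corestrictFD {C D : CoalgCat.{u} k} (f : C ⟶ D) :
    (isFD C).FullSubcategory ⥤ (isFD D).FullSubcategory :=
  (isFD D).lift ((isFD C).ι ⋙ corestrict f) (fun V => V.property)

variable {I : Type w}

/-- The functor from `C`-comodules to the pseudo-pullback of the forgetful functors
`ComodCat (D i) ⥤ ModuleCat k` whose components are the corestriction functors along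
`π i : C ⟶ D i` and the forgetful functor. Corestriction does not change the underlying space, so
the structure isomorphisms are identities. -/
def comparison {C : CoalgCat.{u} k} {D : I → CoalgCat.{u} k} (π : ∀ i, C ⟶ D i) :
    ComodCat C ⥤ PseudoPullback (fun i => fgt (D i)) :=
  PseudoPullback.lift (fun i => corestrict (π i)) (fgt C) (fun _ => Iso.refl _)

/-- The finite-dimensional version of `comparison`. -/
def comparisonFD {C : CoalgCat.{u} k} {D : I → CoalgCat.{u} k} (π : ∀ i, C ⟶ D i) :
    (isFD C).FullSubcategory ⥤ PseudoPullback (fun i => fgtFD (D i)) :=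
  PseudoPullback.lift (fun i => corestrictFD (π i)) (fgtFD C) (fun _ => Iso.refl _)

/-- An object `(V i; V; φ i : V i ≅ V)` of the pseudo-pullback is locally finite if the comodule
structures on `V` transported along the `φ i` leave invariant a common exhaustive (directed)
filtration of `V` by finite-dimensional subspaces. -/
def isLocallyFinite (D : I → CoalgCat.{u} k) :
    ObjectProperty (PseudoPullback (fun i => fgt (D i))) :=
  fun X => ∃ S : Set (Submodule k X.base),
    DirectedOn (· ≤ ·) S ∧ (∀ x : X.base, ∃ W ∈ S, x ∈ W) ∧
      ∀ W ∈ S, Module.Finite k W ∧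
        ∀ i, (X.obj i).IsSubcomodule (W.comap (X.iso i).hom.hom)

/-- The comodules over `C` are, through corestriction along the `π i`, the pseudo-pullback of the
comodules over the `D i` over vector spaces: the comparison functor takes values in, and is an
equivalence onto, the locally finite part of the pseudo-pullback. -/
def RealizesLocallyFinitePseudoPullback {C : CoalgCat.{u} k} {D : I → CoalgCat.{u} k}
    (π : ∀ i, C ⟶ D i) : Prop :=
  ∃ h : ∀ V, isLocallyFinite D ((comparison π).obj V),
    ((isLocallyFinite D).lift (comparison π) h).IsEquivalence

/-- The finite-dimensional comodules over `C` are, through corestriction along the `π i`, the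
pseudo-pullback of the finite-dimensional comodules over the `D i` over finite-dimensional vector
spaces. -/
def RealizesPseudoPullbackFD {C : CoalgCat.{u} k} {D : I → CoalgCat.{u} k}
    (π : ∀ i, C ⟶ D i) : Prop :=
  (comparisonFD π).IsEquivalence

end ComodCat

/-- The functor from Hopf algebras to coalgebras that forgets the algebra structure. -/
def hopfToCoalg (k : Type u) [Field k] : HopfAlgCat.{u} k ⥤ CoalgCat.{u} k :=
  forget₂ (HopfAlgCat.{u} k) (BialgCat.{u} k) ⋙ forget₂ (BialgCat.{u} k) (CoalgCat.{u} k)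

end

/-! ### Coactions and comatrices -/

/-! After a choice of basis, a coaction of `C` on an n-dimensional space is the same as an n × n
comatrix in `C`. Sending an object to the comatrices in its underlying coalgebra is a
corepresentable functor in each of the three settings: by the comatrix coalgebra, by the free
algebra on it, and by the Hopf algebra obtained by freely adjoining all iterated antipodes of its
entries (Takeuchi's construction). A corepresentable functor preserves products, so a comatrix in a
product is the same as a family of comatrices in the factors. This is `LiftsComatrices`, the only
property of products used afterwards.

Hence compatible coactions on a finite-dimensional space lift uniquely to the product. Uniqueness
also gives fullness: a linear map `f : V → W` is a comodule map exactly when the shear (v, w) ↦ (v,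
w + f v) preserves the direct sum coaction on `V × W` (`LiftsComatrices.comm_of_finite`).

Arbitrary dimension reduces to this because every comodule is the union of its finite-dimensional
subcomodules (`IsCoaction.exists_finite_stableUnder`). Conversely, lifted coactions on the members
of a directed cover glue, since inclusions between members are comodule maps
(`LiftsComatrices.exists_coaction_of_directedOn`). -/

section Coaction

variable {k : Type*} [Field k] {C V W : Type*} [AddCommGroup C] [Module k C] [Coalgebra k C]
  [AddCommGroup V] [Module k V] [AddCommGroup W] [Module k W]

/-- A linear map `V → V ⊗ C` is a (right) coaction if it is coassociative and counital. -/
structure IsCoaction (ρ : V →ₗ[k] V ⊗[k] C) : Prop where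
  coassoc : ∀ x, TensorProduct.assoc k V C C (ρ.rTensor C (ρ x)) =
    (Coalgebra.comul (R := k) (A := C)).lTensor V (ρ x)
  counit : ∀ x, TensorProduct.rid k V ((Coalgebra.counit (R := k) (A := C)).lTensor V (ρ x)) = x

omit [Coalgebra k C] in
theorem assoc_rTensor_rTensor (j : V →ₗ[k] W) (t : (V ⊗[k] C) ⊗[k] C) :
    TensorProduct.assoc k W C C ((j.rTensor C).rTensor C t) =
      j.rTensor (C ⊗[k] C) (TensorProduct.assoc k V C C t) := by
  have : (TensorProduct.assoc k W C C).toLinearMap ∘ₗ (j.rTensor C).rTensor C =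
      j.rTensor (C ⊗[k] C) ∘ₗ (TensorProduct.assoc k V C C).toLinearMap := by
    ext; simp
  exact LinearMap.congr_fun this t

theorem lTensor_rTensor_apply {A B : Type*} [AddCommGroup A] [Module k A] [AddCommGroup B]
    [Module k B] (f : A →ₗ[k] B) (j : V →ₗ[k] W) (t : V ⊗[k] A) :
    f.lTensor W (j.rTensor A t) = j.rTensor B (f.lTensor V t) := by
  rw [← LinearMap.comp_apply, ← LinearMap.comp_apply, LinearMap.lTensor_comp_rTensor,
    LinearMap.rTensor_comp_lTensor]

section Hom

variable {ρ : V →ₗ[k] V ⊗[k] C} {σ : W →ₗ[k] W ⊗[k] C} {j : V →ₗ[k] W}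

omit [Coalgebra k C] in
theorem assoc_rTensor_of_comm (h : ∀ x, σ (j x) = j.rTensor C (ρ x)) (x : V) :
    TensorProduct.assoc k W C C (σ.rTensor C (σ (j x))) =
      j.rTensor (C ⊗[k] C) (TensorProduct.assoc k V C C (ρ.rTensor C (ρ x))) := by
  have h' : σ ∘ₗ j = j.rTensor C ∘ₗ ρ := LinearMap.ext h
  rw [h, ← LinearMap.rTensor_comp_apply, h', LinearMap.rTensor_comp_apply, assoc_rTensor_rTensor]

theorem rid_lTensor_of_comm (h : ∀ x, σ (j x) = j.rTensor C (ρ x)) (x : V) :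
    TensorProduct.rid k W ((Coalgebra.counit (R := k) (A := C)).lTensor W (σ (j x))) =
      j (TensorProduct.rid k V ((Coalgebra.counit (R := k) (A := C)).lTensor V (ρ x))) := by
  rw [h, lTensor_rTensor_apply]
  induction (Coalgebra.counit (R := k) (A := C)).lTensor V (ρ x) with
  | zero => simp
  | add x y hx hy => simp only [map_add, hx, hy]
  | tmul x y => simp

/-- Nothing is assumed of `σ` away from the image of `j`, so the axioms for `σ` can be verified
piecewise, on summands or on the members of a cover. -/
theorem IsCoaction.coassoc_of_comm (hρ : IsCoaction ρ) (h : ∀ x, σ (j x) = j.rTensor C (ρ x))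
    (x : V) : TensorProduct.assoc k W C C (σ.rTensor C (σ (j x))) =
      (Coalgebra.comul (R := k) (A := C)).lTensor W (σ (j x)) := by
  rw [assoc_rTensor_of_comm h, hρ.coassoc, h, lTensor_rTensor_apply]

theorem IsCoaction.counit_of_comm (hρ : IsCoaction ρ) (h : ∀ x, σ (j x) = j.rTensor C (ρ x))
    (x : V) :
    TensorProduct.rid k W ((Coalgebra.counit (R := k) (A := C)).lTensor W (σ (j x))) = j x := by
  rw [rid_lTensor_of_comm h, hρ.counit]

/-- Over a field, tensoring keeps `j` injective, so both axioms can be tested after applying `j`. -/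
theorem IsCoaction.of_injective (hσ : IsCoaction σ) (h : ∀ x, σ (j x) = j.rTensor C (ρ x))
    (hj : Function.Injective j) : IsCoaction ρ where
  coassoc x := by
    apply Module.Flat.rTensor_preserves_injective_linearMap (M := C ⊗[k] C) j hj
    rw [← assoc_rTensor_of_comm h, hσ.coassoc, h, lTensor_rTensor_apply]
  counit x := by
    apply hj
    rw [← rid_lTensor_of_comm h, hσ.counit]

/-- The transport of a coaction along a linear equivalence. -/
theorem IsCoaction.conj (hρ : IsCoaction ρ) (e : V ≃ₗ[k] W) :
    IsCoaction (e.toLinearMap.rTensor C ∘ₗ ρ ∘ₗ e.symm.toLinearMap) := by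
  have h : ∀ x, (e.toLinearMap.rTensor C ∘ₗ ρ ∘ₗ e.symm.toLinearMap) (e.toLinearMap x) =
      e.toLinearMap.rTensor C (ρ x) := fun x => by simp
  refine ⟨fun x => ?_, fun x => ?_⟩ <;> obtain ⟨x, rfl⟩ := e.surjective x
  exacts [hρ.coassoc_of_comm h x, hρ.counit_of_comm h x]

end Hom

/-- The direct sum of two linear maps `V → V ⊗ C` and `W → W ⊗ C`. -/
noncomputable def prodCoact (ρ : V →ₗ[k] V ⊗[k] C) (σ : W →ₗ[k] W ⊗[k] C) :
    V × W →ₗ[k] (V × W) ⊗[k] C :=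
  ((LinearMap.inl k V W).rTensor C ∘ₗ ρ).coprod ((LinearMap.inr k V W).rTensor C ∘ₗ σ)

theorem IsCoaction.prod {ρ : V →ₗ[k] V ⊗[k] C} {σ : W →ₗ[k] W ⊗[k] C} (hρ : IsCoaction ρ)
    (hσ : IsCoaction σ) : IsCoaction (prodCoact ρ σ) := by
  have h₁ : ∀ x, prodCoact ρ σ (LinearMap.inl k V W x) = (LinearMap.inl k V W).rTensor C (ρ x) :=
    fun x => by simp [prodCoact]
  have h₂ : ∀ x, prodCoact ρ σ (LinearMap.inr k V W x) = (LinearMap.inr k V W).rTensor C (σ x) :=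
    fun x => by simp [prodCoact]
  have hx : ∀ x : V × W, x = LinearMap.inl k V W x.1 + LinearMap.inr k V W x.2 := by simp
  refine ⟨fun x => ?_, fun x => ?_⟩ <;> rw [hx x] <;> simp only [map_add]
  · rw [hρ.coassoc_of_comm h₁, hσ.coassoc_of_comm h₂]
  · rw [hρ.counit_of_comm h₁, hσ.counit_of_comm h₂]

variable {ι : Type*} [Fintype ι] [DecidableEq ι]

/-- A square matrix of elements of a coalgebra whose entries satisfy
`Δ c i j = ∑ l, c i l ⊗ c l j` and `ε (c i j) = δ i j`. -/
structure IsComatrix (k : Type*) [Field k] {C : Type*} [AddCommGroup C] [Module k C]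
    [Coalgebra k C] {ι : Type*} [Fintype ι] [DecidableEq ι] (c : ι → ι → C) : Prop where
  comul : ∀ i j, Coalgebra.comul (R := k) (c i j) = ∑ l, c i l ⊗ₜ[k] c l j
  counit : ∀ i j, Coalgebra.counit (R := k) (c i j) = if i = j then 1 else 0

theorem IsComatrix.map {c : ι → ι → C} (hc : IsComatrix k c) {D : Type*} [AddCommGroup D]
    [Module k D] [Coalgebra k D] (f : C →ₗc[k] D) : IsComatrix k (fun i j => f (c i j)) where
  comul i j := by
    rw [← CoalgHomClass.map_comp_comul_apply, hc.comul]
    simp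
  counit i j := by rw [CoalgHomClass.counit_comp_apply, hc.counit]

variable (b : Module.Basis ι k V)

/-- The linear map `V → V ⊗ C` with a given matrix of coefficients. -/
noncomputable def matrixCoact (c : ι → ι → C) : V →ₗ[k] V ⊗[k] C :=
  b.constr k fun j => ∑ i, b i ⊗ₜ[k] c i j

omit [Coalgebra k C] in
theorem matrixCoact_basis (c : ι → ι → C) (j : ι) :
    matrixCoact b c (b j) = ∑ i, b i ⊗ₜ[k] c i j := by
  simp [matrixCoact]

theorem sum_basis_tmul_injective {X : Type*} [AddCommGroup X] [Module k X] :
    Function.Injective fun c : ι → X => ∑ i, b i ⊗ₜ[k] c i := by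
  intro c c' h
  have := (TensorProduct.equivFinsuppOfBasisLeft (N := X) b).congr_arg h
  simp only [map_sum] at this
  ext i
  simpa [Finsupp.finsetSum_apply, Finsupp.single_apply] using DFunLike.congr_fun this i

omit [Coalgebra k C] in
theorem exists_eq_matrixCoact (ρ : V →ₗ[k] V ⊗[k] C) : ∃ c : ι → ι → C, ρ = matrixCoact b c := by
  refine ⟨fun i j => TensorProduct.equivFinsuppOfBasisLeft b (ρ (b j)) i, b.ext fun j => ?_⟩
  rw [matrixCoact_basis]
  conv_lhs => rw [← (TensorProduct.equivFinsuppOfBasisLeft b).symm_apply_apply (ρ (b j)),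
    TensorProduct.equivFinsuppOfBasisLeft_symm_apply, Finsupp.sum_fintype _ _ (by simp)]

omit [Coalgebra k C] in
theorem matrixCoact_injective : Function.Injective (matrixCoact (C := C) b) := by
  intro c c' h
  ext i j
  refine congrFun (sum_basis_tmul_injective b (a₁ := fun i => c i j) (a₂ := fun i => c' i j) ?_) i
  simpa [matrixCoact_basis] using LinearMap.congr_fun h (b j)

omit [Coalgebra k C] in
theorem lTensor_comp_matrixCoact {D : Type*} [AddCommGroup D] [Module k D]
    (f : C →ₗ[k] D) (c : ι → ι → C) :
    f.lTensor V ∘ₗ matrixCoact b c = matrixCoact b fun i j => f (c i j) :=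
  b.ext fun j => by simp [matrixCoact_basis]

/-- Both axioms, evaluated at `b j`, are equalities of sums `∑ i, b i ⊗ _`; comparing the
coefficients of `b i` gives the comatrix identities. -/
theorem isCoaction_matrixCoact_iff (c : ι → ι → C) :
    IsCoaction (matrixCoact b c) ↔ IsComatrix k c := by
  have h₁ : ∀ j, TensorProduct.assoc k V C C
      ((matrixCoact b c).rTensor C (matrixCoact b c (b j))) =
        ∑ i, b i ⊗ₜ[k] ∑ l, c i l ⊗ₜ[k] c l j := fun j => by
    simp only [matrixCoact_basis, map_sum, LinearMap.rTensor_tmul, TensorProduct.sum_tmul,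
      TensorProduct.assoc_tmul, TensorProduct.tmul_sum]
    exact Finset.sum_comm
  have h₂ : ∀ j, (Coalgebra.comul (R := k) (A := C)).lTensor V (matrixCoact b c (b j)) =
      ∑ i, b i ⊗ₜ[k] Coalgebra.comul (R := k) (c i j) := fun j => by simp [matrixCoact_basis]
  have h₃ : ∀ j, TensorProduct.rid k V
      ((Coalgebra.counit (R := k) (A := C)).lTensor V (matrixCoact b c (b j))) =
        ∑ i, Coalgebra.counit (R := k) (c i j) • b i := fun j => by simp [matrixCoact_basis]
  constructor
  · refine fun h => ⟨fun i j => ?_, fun i j => ?_⟩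
    · have := h.coassoc (b j)
      rw [h₁, h₂] at this
      exact (congrFun (sum_basis_tmul_injective b this) i).symm
    · have := h.counit (b j)
      rw [h₃] at this
      simpa [Finsupp.single_apply, eq_comm (a := j)] using
        DFunLike.congr_fun (congrArg b.repr this) i
  · refine fun h => ⟨fun x => ?_, fun x => ?_⟩
    · refine LinearMap.congr_fun (f := (TensorProduct.assoc k V C C).toLinearMap ∘ₗ
        (matrixCoact b c).rTensor C ∘ₗ matrixCoact b c)
        (g := (Coalgebra.comul (R := k) (A := C)).lTensor V ∘ₗ matrixCoact b c)
        (b.ext fun j => ?_) x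
      simp only [LinearMap.comp_apply, LinearEquiv.coe_coe]
      rw [h₁, h₂]
      simp only [h.comul]
    · refine LinearMap.congr_fun (f := (TensorProduct.rid k V).toLinearMap ∘ₗ
        (Coalgebra.counit (R := k) (A := C)).lTensor V ∘ₗ matrixCoact b c)
        (g := LinearMap.id) (b.ext fun j => ?_) x
      simp only [LinearMap.comp_apply, LinearEquiv.coe_coe]
      rw [h₃]
      simp [h.counit]

end Coaction

/-! ### Lifting coactions along a universal family of coalgebra morphisms -/

section Stable

variable {k : Type*} [Field k] {C V : Type*} [AddCommGroup C] [Module k C]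
  [AddCommGroup V] [Module k V]

/-- A subspace is stable under a map `V → V ⊗ C` if it is mapped into `W ⊗ C`. -/
def StableUnder (ρ : V →ₗ[k] V ⊗[k] C) (W : Submodule k V) : Prop :=
  ∀ x ∈ W, ρ x ∈ LinearMap.range (W.subtype.rTensor C)

theorem StableUnder.exists_restrict {ρ : V →ₗ[k] V ⊗[k] C} {W : Submodule k V}
    (h : StableUnder ρ W) : ∃ σ : W →ₗ[k] W ⊗[k] C, ∀ x, ρ (W.subtype x) =
      W.subtype.rTensor C (σ x) := by
  have hinj : Function.Injective (W.subtype.rTensor C) :=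
    Module.Flat.rTensor_preserves_injective_linearMap _ W.injective_subtype
  refine ⟨(LinearEquiv.ofInjective _ hinj).symm.toLinearMap ∘ₗ
    (ρ ∘ₗ W.subtype).codRestrict _ fun x => h x x.2, fun x => ?_⟩
  have := congrArg Subtype.val ((LinearEquiv.ofInjective _ hinj).apply_symm_apply
    ((ρ ∘ₗ W.subtype).codRestrict _ (fun x => h x x.2) x))
  exact this.symm

theorem range_rTensor_subtype_mono {W W' : Submodule k V} (h : W ≤ W') :
    LinearMap.range (W.subtype.rTensor C) ≤ LinearMap.range (W'.subtype.rTensor C) := by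
  rw [← Submodule.subtype_comp_inclusion W W' h, LinearMap.rTensor_comp]
  exact LinearMap.range_comp_le_range _ _

theorem StableUnder.sup {ρ : V →ₗ[k] V ⊗[k] C} {W W' : Submodule k V} (h : StableUnder ρ W)
    (h' : StableUnder ρ W') : StableUnder ρ (W ⊔ W') := by
  intro x hx
  obtain ⟨y, hy, z, hz, rfl⟩ := Submodule.mem_sup.1 hx
  rw [map_add]
  exact add_mem (range_rTensor_subtype_mono le_sup_left (h y hy))
    (range_rTensor_subtype_mono le_sup_right (h' z hz))

theorem StableUnder.lTensor {ρ : V →ₗ[k] V ⊗[k] C} {W : Submodule k V} (h : StableUnder ρ W)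
    {D : Type*} [AddCommGroup D] [Module k D] (f : C →ₗ[k] D) :
    StableUnder (f.lTensor V ∘ₗ ρ) W := by
  intro x hx
  obtain ⟨t, ht⟩ := h x hx
  exact ⟨f.lTensor W t, by rw [← lTensor_rTensor_apply, ht, LinearMap.comp_apply]⟩

/-- Every tensor lies in `W ⊗ C` for some finite-dimensional `W`, spanned by the images of the
tensor under functionals on `C`. -/
theorem exists_slices (t : V ⊗[k] C) : ∃ s : Finset (C →ₗ[k] k),
    t ∈ LinearMap.range ((Submodule.span k ((fun φ : C →ₗ[k] k =>
      TensorProduct.rid k V (φ.lTensor V t)) '' (s : Set (C →ₗ[k] k)))).subtype.rTensor C) := by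
  classical
  let b := Module.Basis.ofVectorSpace k C
  -- The functionals are the coordinates along the finitely many basis vectors of `C` that occur in
  -- `t`; the slices are then the coefficients of `t`.
  refine ⟨(TensorProduct.equivFinsuppOfBasisRight b t).support.image b.coord, ?_⟩
  have ht := (TensorProduct.equivFinsuppOfBasisRight b).symm_apply_apply t
  rw [TensorProduct.equivFinsuppOfBasisRight_symm_apply] at ht
  refine (congrArg (fun y => y ∈ LinearMap.range _) ht).mp ?_
  refine Submodule.finsuppSum_mem _ _ _ _ fun i hi => ?_
  rw [TensorProduct.equivFinsuppOfBasisRight_apply]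
  exact LinearMap.mem_range.2 ⟨(⟨_, Submodule.subset_span
    ⟨b.coord i, Finset.mem_coe.2 (Finset.mem_image_of_mem _ (Finsupp.mem_support_iff.2 hi)), rfl⟩⟩ :
      Submodule.span k ((fun φ : C →ₗ[k] k => TensorProduct.rid k V (φ.lTensor V t)) '' _)) ⊗ₜ b i,
    LinearMap.rTensor_tmul _ _ _ _⟩

end Stable

/-! ### Local finiteness of comodules. -/

section LocallyFinite

variable {k : Type*} [Field k] {C V : Type*} [AddCommGroup C] [Module k C] [Coalgebra k C]
  [AddCommGroup V] [Module k V]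

/-- Every element of a comodule lies in a finite-dimensional subcomodule. -/
theorem IsCoaction.exists_finite_stableUnder {ρ : V →ₗ[k] V ⊗[k] C} (hρ : IsCoaction ρ) (x : V) :
    ∃ W : Submodule k V, Module.Finite k W ∧ StableUnder ρ W ∧ x ∈ W := by
  obtain ⟨s, hs⟩ := exists_slices (ρ x)
  set W := Submodule.span k ((fun φ : C →ₗ[k] k =>
      TensorProduct.rid k V (φ.lTensor V (ρ x))) '' (s : Set (C →ₗ[k] k))) with hW
  refine ⟨W, Module.Finite.span_of_finite k (s.finite_toSet.image _), ?_, ?_⟩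
  · suffices W ≤ (LinearMap.range (W.subtype.rTensor C)).comap ρ from fun y hy => this hy
    rw [hW, Submodule.span_le, ← hW]
    rintro _ ⟨φ, -, rfl⟩
    -- By coassociativity, `ρ` of a slice of `ρ x` arises from `ρ x` by a linear map acting on the
    -- factor `C` alone. Such a map keeps `W ⊗ C` inside `W ⊗ C`.
    have key : ρ (TensorProduct.rid k V (φ.lTensor V (ρ x))) =
        ((TensorProduct.rid k C).toLinearMap ∘ₗ φ.lTensor C ∘ₗ
          Coalgebra.comul (R := k)).lTensor V (ρ x) := by
      simp only [LinearMap.lTensor_comp_apply]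
      rw [← hρ.coassoc]
      induction ρ x with
      | zero => simp
      | add y z hy hz => simp only [map_add, hy, hz]
      | tmul y c =>
        simp only [LinearMap.lTensor_tmul, TensorProduct.rid_tmul, map_smul,
          LinearMap.rTensor_tmul]
        induction ρ y with
        | zero => simp
        | add a b ha hb => simp only [smul_add, TensorProduct.add_tmul, map_add, ha, hb]
        | tmul a b => simp
    obtain ⟨t, ht⟩ := hs
    simp only [Submodule.comap_coe, Set.mem_preimage, SetLike.mem_coe]
    rw [key, ← ht, lTensor_rTensor_apply]
    exact ⟨_, rfl⟩
  -- Counitality recovers `x` from `ρ x`, which lies in `W ⊗ C`.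
  · obtain ⟨t, ht⟩ := hs
    rw [← hρ.counit x, ← ht, lTensor_rTensor_apply]
    have : ∀ t : W ⊗[k] k, TensorProduct.rid k V (W.subtype.rTensor k t) =
        W.subtype (TensorProduct.rid k W t) := fun t => by
      induction t with
      | zero => simp
      | add y z hy hz => simp only [map_add, hy, hz]
      | tmul y z => simp
    rw [this]
    exact Subtype.property _

end LocallyFinite

/-! ### Consequences of lifting comatrices: coactions and their morphisms. -/

section Universal

variable {k : Type*} [Field k] {I : Type*} {C : Type*} {D : I → Type*} [AddCommGroup C]
  [Module k C] [Coalgebra k C] [∀ i, AddCommGroup (D i)] [∀ i, Module k (D i)]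
  [∀ i, Coalgebra k (D i)]

/-- A family of coalgebra morphisms `π i : C → D i` such that comatrices in `C` correspond to
families of comatrices in the `D i`. -/
structure LiftsComatrices (π : ∀ i, C →ₗc[k] D i) : Prop where
  exists_lift : ∀ (n : ℕ) (c : ∀ i, Fin n → Fin n → D i), (∀ i, IsComatrix k (c i)) →
    ∃ c' : Fin n → Fin n → C, IsComatrix k c' ∧ ∀ i j l, π i (c' j l) = c i j l
  ext : ∀ (n : ℕ) (c c' : Fin n → Fin n → C), IsComatrix k c → IsComatrix k c' →
    (∀ i j l, π i (c j l) = π i (c' j l)) → c = c'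

namespace LiftsComatrices

variable {π : ∀ i, C →ₗc[k] D i} (hπ : LiftsComatrices π) {V W : Type*} [AddCommGroup V]
  [Module k V] [AddCommGroup W] [Module k W]

include hπ

theorem exists_coaction [Module.Finite k V] {ρ : ∀ i, V →ₗ[k] V ⊗[k] D i}
    (hρ : ∀ i, IsCoaction (ρ i)) : ∃ ρ' : V →ₗ[k] V ⊗[k] C, IsCoaction ρ' ∧
      ∀ i, (π i : C →ₗ[k] D i).lTensor V ∘ₗ ρ' = ρ i := by
  let b := Module.finBasis k V
  choose c hc using fun i => exists_eq_matrixCoact b (ρ i)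
  obtain ⟨c', hc', h⟩ := hπ.exists_lift _ c fun i =>
    (isCoaction_matrixCoact_iff b _).1 (hc i ▸ hρ i)
  refine ⟨matrixCoact b c', (isCoaction_matrixCoact_iff b _).2 hc', fun i => ?_⟩
  rw [lTensor_comp_matrixCoact, hc i]
  exact congrArg _ (funext₂ (h i))

theorem coaction_ext [Module.Finite k V] {ρ σ : V →ₗ[k] V ⊗[k] C} (hρ : IsCoaction ρ)
    (hσ : IsCoaction σ) (h : ∀ i, (π i : C →ₗ[k] D i).lTensor V ∘ₗ ρ =
      (π i : C →ₗ[k] D i).lTensor V ∘ₗ σ) : ρ = σ := by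
  let b := Module.finBasis k V
  obtain ⟨c, rfl⟩ := exists_eq_matrixCoact b ρ
  obtain ⟨c', rfl⟩ := exists_eq_matrixCoact b σ
  simp only [lTensor_comp_matrixCoact] at h
  rw [hπ.ext _ c c' ((isCoaction_matrixCoact_iff b _).1 hρ) ((isCoaction_matrixCoact_iff b _).1 hσ)
    fun i j l => congrFun₂ (matrixCoact_injective b (h i)) j l]

/-- Fullness is deduced from uniqueness of coactions: conjugating the direct sum coaction by the
shear attached to `f` gives a second coaction of `C` on `V × W`. The two agree after each `π i`,
hence agree. -/
theorem comm_of_finite [Module.Finite k V] [Module.Finite k W] {ρ : V →ₗ[k] V ⊗[k] C}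
    {σ : W →ₗ[k] W ⊗[k] C} (hρ : IsCoaction ρ) (hσ : IsCoaction σ) (f : V →ₗ[k] W)
    (h : ∀ i x, (π i : C →ₗ[k] D i).lTensor W (σ (f x)) =
      f.rTensor (D i) ((π i : C →ₗ[k] D i).lTensor V (ρ x))) (x : V) :
    σ (f x) = f.rTensor C (ρ x) := by
  let e : (V × W) ≃ₗ[k] V × W := LinearEquiv.ofLinearMap
    (LinearMap.id + LinearMap.inr k V W ∘ₗ f ∘ₗ LinearMap.fst k V W)
    (LinearMap.id - LinearMap.inr k V W ∘ₗ f ∘ₗ LinearMap.fst k V W)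
    (by ext <;> simp) (by ext <;> simp)
  have hinl : e.toLinearMap ∘ₗ LinearMap.inl k V W =
      LinearMap.inl k V W + LinearMap.inr k V W ∘ₗ f := by ext <;> simp [e]
  have hinr : e.toLinearMap ∘ₗ LinearMap.inr k V W = LinearMap.inr k V W := by
    ext <;> simp [e]
  have key := hπ.coaction_ext ((hρ.prod hσ).conj e) (hρ.prod hσ) fun i => by
    suffices (π i : C →ₗ[k] D i).lTensor (V × W) ∘ₗ e.toLinearMap.rTensor C ∘ₗ prodCoact ρ σ =
        (π i : C →ₗ[k] D i).lTensor (V × W) ∘ₗ prodCoact ρ σ ∘ₗ e.toLinearMap by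
      refine LinearMap.ext fun y => ?_
      obtain ⟨y, rfl⟩ := e.surjective y
      simpa using LinearMap.congr_fun this y
    refine LinearMap.ext fun y => ?_
    obtain ⟨v, w⟩ := y
    have he : e (v, w) = (v, w + f v) := by simp [e]
    simp only [LinearMap.comp_apply, prodCoact, LinearMap.coprod_apply, map_add,
      LinearEquiv.coe_coe, he]
    simp only [← LinearMap.rTensor_comp_apply, hinl, hinr]
    simp only [lTensor_rTensor_apply, LinearMap.rTensor_add, LinearMap.add_apply, h,
      LinearMap.rTensor_comp_apply, map_add]
    abel
  -- At `(x, f x) = e (x, 0)` the two coactions have the same `V`-part, and their `W`-parts are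
  -- `f.rTensor C (ρ x)` and `σ (f x)`.
  have := LinearMap.congr_fun key (e (x, 0))
  have he : e (x, 0) = (x, f x) := by simp [e]
  have he' : e.symm (x, f x) = (x, 0) := by rw [← he, e.symm_apply_apply]
  simp only [LinearMap.comp_apply, LinearEquiv.coe_coe, he, he'] at this
  simp only [prodCoact, LinearMap.coprod_apply, LinearMap.comp_apply, map_zero, add_zero] at this
  rw [← LinearMap.rTensor_comp_apply, hinl] at this
  simp only [LinearMap.rTensor_add, LinearMap.add_apply, LinearMap.rTensor_comp_apply,
    add_right_inj] at this
  exact (Module.Flat.rTensor_preserves_injective_linearMap (M := C) _ LinearMap.inr_injective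
    this).symm

/-- A linear map between comodules that commutes with all corestricted coactions is a comodule
morphism. -/
theorem comm {ρ : V →ₗ[k] V ⊗[k] C} {σ : W →ₗ[k] W ⊗[k] C} (hρ : IsCoaction ρ)
    (hσ : IsCoaction σ) (f : V →ₗ[k] W)
    (h : ∀ i x, (π i : C →ₗ[k] D i).lTensor W (σ (f x)) =
      f.rTensor (D i) ((π i : C →ₗ[k] D i).lTensor V (ρ x))) (x : V) :
    σ (f x) = f.rTensor C (ρ x) := by
  obtain ⟨V', _, hV', hx⟩ := hρ.exists_finite_stableUnder x
  -- `V'.map f` is not yet known to be stable, so it is enclosed in a finite sum of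
  -- finite-dimensional subcomodules, one for each generator.
  have hW : ∃ W' : Submodule k W, Module.Finite k W' ∧ StableUnder σ W' ∧ V'.map f ≤ W' := by
    have hfg : (V'.map f).FG := (Module.Finite.iff_fg.1 ‹_›).map f
    generalize V'.map f = M at hfg
    induction M, hfg using Submodule.fg_induction with
    | singleton y =>
      obtain ⟨W', h₁, h₂, h₃⟩ := hσ.exists_finite_stableUnder y
      exact ⟨W', h₁, h₂, by simpa using h₃⟩
    | sup M N _ _ hM hN =>
      obtain ⟨M', _, h₂, h₃⟩ := hM
      obtain ⟨N', _, h₅, h₆⟩ := hN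
      exact ⟨M' ⊔ N', inferInstance, h₂.sup h₅, sup_le_sup h₃ h₆⟩
  obtain ⟨W', _, hW', hf⟩ := hW
  obtain ⟨ρ', hρ'⟩ := hV'.exists_restrict
  obtain ⟨σ', hσ'⟩ := hW'.exists_restrict
  let f' : V' →ₗ[k] W' := (f ∘ₗ V'.subtype).codRestrict W' fun y => hf ⟨y, y.2, rfl⟩
  have hf' : W'.subtype ∘ₗ f' = f ∘ₗ V'.subtype := rfl
  have hff : ∀ y, W'.subtype (f' y) = f (V'.subtype y) := fun _ => rfl
  have := hπ.comm_of_finite (hρ.of_injective hρ' V'.injective_subtype)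
    (hσ.of_injective hσ' W'.injective_subtype) f' (fun i y => by
      apply Module.Flat.rTensor_preserves_injective_linearMap (M := D i) _ W'.injective_subtype
      rw [← lTensor_rTensor_apply, ← hσ', ← LinearMap.rTensor_comp_apply, hf',
        LinearMap.rTensor_comp_apply, ← lTensor_rTensor_apply, ← hρ', hff, h]) ⟨x, hx⟩
  have := congrArg (W'.subtype.rTensor C) this
  rwa [← hσ', ← LinearMap.rTensor_comp_apply, hf', LinearMap.rTensor_comp_apply, ← hρ'] at this

/-- Coactions of the `D i` on `V` that leave invariant the members of a directed cover of `V` by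
finite-dimensional subspaces are induced by a coaction of `C`. -/
theorem exists_coaction_of_directedOn {ρ : ∀ i, V →ₗ[k] V ⊗[k] D i}
    (hρ : ∀ i, IsCoaction (ρ i)) {S : Set (Submodule k V)} (hS : DirectedOn (· ≤ ·) S)
    (hcov : ∀ x, ∃ W ∈ S, x ∈ W) (hfin : ∀ W ∈ S, Module.Finite k W)
    (hstab : ∀ W ∈ S, ∀ i, StableUnder (ρ i) W) : ∃ ρ' : V →ₗ[k] V ⊗[k] C, IsCoaction ρ' ∧
      ∀ i, (π i : C →ₗ[k] D i).lTensor V ∘ₗ ρ' = ρ i := by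
  have hloc : ∀ W : S, ∃ σ : W.1 →ₗ[k] W.1 ⊗[k] C, IsCoaction σ ∧
      ∀ i x, W.1.subtype.rTensor (D i) ((π i : C →ₗ[k] D i).lTensor W.1 (σ x)) =
        ρ i (W.1.subtype x) := fun ⟨W, hW⟩ => by
    have := hfin W hW
    choose τ hτ using fun i => (hstab W hW i).exists_restrict
    obtain ⟨σ, hσ, h⟩ := hπ.exists_coaction
      fun i => (hρ i).of_injective (hτ i) W.injective_subtype
    exact ⟨σ, hσ, fun i x => by rw [hτ, ← h]; rfl⟩
  choose σ hσ hσρ using hloc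
  -- The inclusion `W ≤ W'` commutes with the coactions of every `D i`, hence with the lifted ones.
  have hcompat : ∀ (W W' : S) (h : W.1 ≤ W'.1) (x : W.1),
      W'.1.subtype.rTensor C (σ W' (Submodule.inclusion h x)) =
        W.1.subtype.rTensor C (σ W x) := fun W W' h x => by
    have := hfin W W.2
    have := hfin W' W'.2
    rw [hπ.comm_of_finite (hσ W) (hσ W') (Submodule.inclusion h) (fun i y => ?_) x,
      ← LinearMap.rTensor_comp_apply, Submodule.subtype_comp_inclusion]
    apply Module.Flat.rTensor_preserves_injective_linearMap (M := D i) _ W'.1.injective_subtype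
    rw [hσρ, ← LinearMap.rTensor_comp_apply, Submodule.subtype_comp_inclusion, hσρ]
    rfl
  choose w hwS hw using hcov
  let r : V → V ⊗[k] C := fun x => (w x).subtype.rTensor C (σ ⟨w x, hwS x⟩ ⟨x, hw x⟩)
  -- The value of `r` does not depend on the chosen `w x`: it is compared with any other member
  -- containing `x` inside a common upper bound.
  have hr : ∀ (W : S) (x : W.1), r (W.1.subtype x) = W.1.subtype.rTensor C (σ W x) := fun W x => by
    obtain ⟨W', hW', h₁, h₂⟩ := hS (w x) (hwS x) W.1 W.2
    rw [← hcompat W ⟨W', hW'⟩ h₂ x]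
    exact (hcompat ⟨w x, hwS x⟩ ⟨W', hW'⟩ h₁ ⟨x, hw x⟩).symm
  let ρ' : V →ₗ[k] V ⊗[k] C :=
    { toFun := r
      map_add' := fun x y => by
        obtain ⟨W, hW, h₁, h₂⟩ := hS (w x) (hwS x) (w y) (hwS y)
        have hx := hr ⟨W, hW⟩ ⟨x, h₁ (hw x)⟩
        have hy := hr ⟨W, hW⟩ ⟨y, h₂ (hw y)⟩
        have hxy := hr ⟨W, hW⟩ (⟨x, h₁ (hw x)⟩ + ⟨y, h₂ (hw y)⟩)
        rw [map_add, map_add, map_add, ← hx, ← hy] at hxy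
        exact hxy
      map_smul' := fun a x => by
        have hx := hr ⟨w x, hwS x⟩ ⟨x, hw x⟩
        have hax := hr ⟨w x, hwS x⟩ (a • ⟨x, hw x⟩)
        rw [map_smul, map_smul, map_smul, ← hx] at hax
        exact hax }
  have hρ' : ∀ (W : S) (x : W.1), ρ' (W.1.subtype x) = W.1.subtype.rTensor C (σ W x) := hr
  refine ⟨ρ', ⟨fun x => ?_, fun x => ?_⟩, fun i => LinearMap.ext fun x => ?_⟩
  · exact (hσ ⟨w x, hwS x⟩).coassoc_of_comm (hρ' _) ⟨x, hw x⟩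
  · exact (hσ ⟨w x, hwS x⟩).counit_of_comm (hρ' _) ⟨x, hw x⟩
  · refine Eq.trans ?_ (hσρ ⟨w x, hwS x⟩ i ⟨x, hw x⟩)
    rw [← lTensor_rTensor_apply]
    rfl

end LiftsComatrices

end Universal

/-! ### Coalgebras and bialgebras freely generated by a comatrix -/

section Representing

variable (k : Type u) [Field k] (n : ℕ)

/-- The comatrix coalgebra, with basis the matrix units. -/
def ComatrixCoalgebra : Type u := Fin n × Fin n →₀ k

namespace ComatrixCoalgebra

noncomputable instance : AddCommGroup (ComatrixCoalgebra k n) :=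
  inferInstanceAs (AddCommGroup (Fin n × Fin n →₀ k))

noncomputable instance : Module k (ComatrixCoalgebra k n) :=
  inferInstanceAs (Module k (Fin n × Fin n →₀ k))

/-- The basis of matrix units. -/
noncomputable def basis : Module.Basis (Fin n × Fin n) k (ComatrixCoalgebra k n) :=
  Module.Basis.ofRepr (LinearEquiv.refl k (Fin n × Fin n →₀ k))

noncomputable instance : CoalgebraStruct k (ComatrixCoalgebra k n) where
  comul := (basis k n).constr k fun p => ∑ l, basis k n (p.1, l) ⊗ₜ[k] basis k n (l, p.2)
  counit := (basis k n).constr k fun p => if p.1 = p.2 then 1 else 0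

theorem comul_basis (i j : Fin n) : Coalgebra.comul (R := k) (basis k n (i, j)) =
    ∑ l, basis k n (i, l) ⊗ₜ[k] basis k n (l, j) :=
  (basis k n).constr_basis k _ _

theorem counit_basis (i j : Fin n) :
    Coalgebra.counit (R := k) (basis k n (i, j)) = if i = j then 1 else 0 :=
  (basis k n).constr_basis k _ _

noncomputable instance : Coalgebra k (ComatrixCoalgebra k n) where
  coassoc := (basis k n).ext fun ⟨i, j⟩ => by
    simp only [LinearMap.comp_apply, LinearEquiv.coe_coe, comul_basis, map_sum,
      LinearMap.rTensor_tmul, LinearMap.lTensor_tmul, TensorProduct.sum_tmul,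
      TensorProduct.tmul_sum, TensorProduct.assoc_tmul]
    exact Finset.sum_comm
  rTensor_counit_comp_comul := (basis k n).ext fun ⟨i, j⟩ => by
    simp [comul_basis, counit_basis, TensorProduct.ite_tmul]
  lTensor_counit_comp_comul := (basis k n).ext fun ⟨i, j⟩ => by
    simp [comul_basis, counit_basis, TensorProduct.tmul_ite]

theorem isComatrix_basis : IsComatrix k fun i j => basis k n (i, j) :=
  ⟨comul_basis k n, counit_basis k n⟩

variable {k n}

/-- The coalgebra morphism that corresponds to a comatrix. -/
noncomputable def lift {C : Type*} [AddCommGroup C] [Module k C] [Coalgebra k C]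
    {c : Fin n → Fin n → C} (hc : IsComatrix k c) : ComatrixCoalgebra k n →ₗc[k] C where
  toLinearMap := (basis k n).constr k fun p => c p.1 p.2
  counit_comp := (basis k n).ext fun ⟨i, j⟩ => by simp [counit_basis, hc.counit]
  map_comp_comul := (basis k n).ext fun ⟨i, j⟩ => by
    simp [comul_basis, hc.comul]

theorem lift_basis {C : Type*} [AddCommGroup C] [Module k C] [Coalgebra k C]
    {c : Fin n → Fin n → C} (hc : IsComatrix k c) (i j : Fin n) :
    lift hc (basis k n (i, j)) = c i j :=
  (basis k n).constr_basis k _ _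

end ComatrixCoalgebra

/-- The free algebra on the matrix units, as a bialgebra. -/
def ComatrixBialgebra : Type u := FreeAlgebra k (Fin n × Fin n)

namespace ComatrixBialgebra

noncomputable instance : Ring (ComatrixBialgebra k n) :=
  inferInstanceAs (Ring (FreeAlgebra k (Fin n × Fin n)))

noncomputable instance : Algebra k (ComatrixBialgebra k n) :=
  inferInstanceAs (Algebra k (FreeAlgebra k (Fin n × Fin n)))

/-- The generators. -/
noncomputable def gen (i j : Fin n) : ComatrixBialgebra k n :=
  FreeAlgebra.ι k (i, j)

variable {k n}

/-- The algebra morphism given by the images of the generators. -/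
noncomputable def liftAlgHom {A : Type*} [Semiring A] [Algebra k A] (c : Fin n → Fin n → A) :
    ComatrixBialgebra k n →ₐ[k] A :=
  FreeAlgebra.lift k fun p => c p.1 p.2

@[simp]
theorem liftAlgHom_gen {A : Type*} [Semiring A] [Algebra k A] (c : Fin n → Fin n → A)
    (i j : Fin n) : liftAlgHom (k := k) c (gen k n i j) = c i j :=
  FreeAlgebra.lift_ι_apply _ _

theorem algHom_ext {A : Type*} [Semiring A] [Algebra k A] {f g : ComatrixBialgebra k n →ₐ[k] A}
    (h : ∀ i j, f (gen k n i j) = g (gen k n i j)) : f = g :=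
  FreeAlgebra.hom_ext (funext fun p => h p.1 p.2)

noncomputable instance : Bialgebra k (ComatrixBialgebra k n) :=
  .ofAlgHom (liftAlgHom fun i j => ∑ l, gen k n i l ⊗ₜ[k] gen k n l j)
    (liftAlgHom fun i j => if i = j then 1 else 0)
    (algHom_ext fun i j => by
      simp only [AlgHom.comp_apply, liftAlgHom_gen, map_sum, Algebra.TensorProduct.map_tmul,
        TensorProduct.sum_tmul, TensorProduct.tmul_sum, AlgHom.id_apply]
      simpa using Finset.sum_comm)
    (algHom_ext fun i j => by simp [TensorProduct.ite_tmul])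
    (algHom_ext fun i j => by simp [TensorProduct.tmul_ite])

theorem isComatrix_gen : IsComatrix k (gen k n) :=
  ⟨liftAlgHom_gen _, liftAlgHom_gen _⟩

/-- The bialgebra morphism that corresponds to a comatrix. -/
noncomputable def lift {B : Type*} [Ring B] [Bialgebra k B] {c : Fin n → Fin n → B}
    (hc : IsComatrix k c) : ComatrixBialgebra k n →ₐc[k] B :=
  .ofAlgHom (liftAlgHom c)
    (algHom_ext fun i j => by simp [hc.counit, isComatrix_gen.counit])
    (algHom_ext fun i j => by simp [hc.comul, isComatrix_gen.comul])

theorem lift_gen {B : Type*} [Ring B] [Bialgebra k B] {c : Fin n → Fin n → B}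
    (hc : IsComatrix k c) (i j : Fin n) : lift hc (gen k n i j) = c i j :=
  liftAlgHom_gen _ _ _

end ComatrixBialgebra

end Representing

/-! ### Products and corepresentability of comatrices. -/

section Limit

variable {k : Type u} [Field k]

/-- If comatrices in the coalgebras `U B` are corepresentable, then the projections of a product
become universal for comatrices under `U`. -/
theorem liftsComatrices_of_isLimit {A : Type u₁} [Category.{v₁} A] (U : A ⥤ CoalgCat.{u} k)
    (hU : ∀ n, ∃ (F : A) (x : Fin n → Fin n → U.obj F), IsComatrix k x ∧
      ∀ (B : A) (c : Fin n → Fin n → U.obj B), IsComatrix k c →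
        ∃! g : F ⟶ B, ∀ i j, (U.map g).toCoalgHom (x i j) = c i j)
    {I : Type w} {H : I → A} (P : Fan H) (hP : IsLimit P) :
    LiftsComatrices fun i => (U.map (P.proj i)).toCoalgHom where
  exists_lift n c hc := by
    obtain ⟨F, x, hx, h⟩ := hU n
    choose g hg using fun i => (h (H i) (c i) (hc i)).exists
    refine ⟨fun i j => (U.map (Fan.IsLimit.lift hP g)).toCoalgHom (x i j),
      hx.map (U.map (Fan.IsLimit.lift hP g)).toCoalgHom, fun i j l => ?_⟩
    rw [← hg i, ← Fan.IsLimit.fac hP g i, U.map_comp]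
    rfl
  ext n c c' hc hc' hcc := by
    obtain ⟨F, x, hx, h⟩ := hU n
    obtain ⟨g, hg, -⟩ := h _ c hc
    obtain ⟨g', hg', -⟩ := h _ c' hc'
    have : g = g' := Fan.IsLimit.hom_ext hP _ _ fun i => by
      -- Both composites with the `i`-th projection classify the same comatrix in `H i`.
      refine (h (H i) _ (hc.map (U.map (P.proj i)).toCoalgHom)).unique (fun j l => ?_) fun j l => ?_
      · rw [U.map_comp]
        exact congrArg _ (hg j l)
      · rw [U.map_comp, hcc]
        exact congrArg _ (hg' j l)
    ext i j
    rw [← hg, ← hg', this]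

theorem CoalgCat.liftsComatrices {I : Type w} {H : I → CoalgCat.{u} k} (P : Fan H)
    (hP : IsLimit P) : LiftsComatrices fun i => (P.proj i).toCoalgHom :=
  liftsComatrices_of_isLimit (𝟭 _) (fun n => ⟨CoalgCat.of k (ComatrixCoalgebra k n),
    fun i j => ComatrixCoalgebra.basis k n (i, j), ComatrixCoalgebra.isComatrix_basis k n,
    fun _ _ hc => ⟨CoalgCat.ofHom (ComatrixCoalgebra.lift hc), ComatrixCoalgebra.lift_basis hc,
      fun _ hg => CoalgCat.hom_ext _ _ (CoalgHom.coe_linearMap_injective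
        ((ComatrixCoalgebra.basis k n).ext fun p =>
          (hg p.1 p.2).trans (ComatrixCoalgebra.lift_basis hc p.1 p.2).symm))⟩⟩) P hP

theorem BialgCat.liftsComatrices {I : Type w} {H : I → BialgCat.{u} k} (P : Fan H)
    (hP : IsLimit P) : LiftsComatrices fun i =>
      ((forget₂ (BialgCat.{u} k) (CoalgCat.{u} k)).map (P.proj i)).toCoalgHom :=
  liftsComatrices_of_isLimit (forget₂ (BialgCat.{u} k) (CoalgCat.{u} k)) (fun n =>
    ⟨BialgCat.of k (ComatrixBialgebra k n), ComatrixBialgebra.gen k n,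
    ComatrixBialgebra.isComatrix_gen,
    fun B _ hc => ⟨BialgCat.ofHom (ComatrixBialgebra.lift (B := B) hc),
      ComatrixBialgebra.lift_gen (B := B) hc,
      fun _ hg => BialgCat.hom_ext _ _ (BialgHom.coe_toAlgHom_injective
        (ComatrixBialgebra.algHom_ext fun i j =>
          (hg i j).trans (ComatrixBialgebra.lift_gen (B := B) hc i j).symm))⟩⟩) P hP

end Limit

/-! ### The Hopf algebra freely generated by a comatrix -/

section Antipode

variable {k : Type*} [Field k] {A : Type*} [Ring A] [Bialgebra k A]

/-- The linear map underlying an antihomomorphism of algebras. -/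
noncomputable def antiLinear (S : A →ₐ[k] Aᵐᵒᵖ) : A →ₗ[k] A :=
  (MulOpposite.opLinearEquiv k).symm.toLinearMap ∘ₗ S.toLinearMap

theorem antiLinear_mul (S : A →ₐ[k] Aᵐᵒᵖ) (a b : A) :
    antiLinear S (a * b) = antiLinear S b * antiLinear S a := by
  simp [antiLinear]

theorem antiLinear_algebraMap (S : A →ₐ[k] Aᵐᵒᵖ) (r : k) :
    antiLinear S (algebraMap k A r) = algebraMap k A r := by
  simp [antiLinear]

variable {S : A →ₐ[k] Aᵐᵒᵖ} {s : Set A}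

/-- The left antipode axiom for an antihomomorphism can be checked on algebra generators. -/
theorem mul_rTensor_comul_of_adjoin (hs : Algebra.adjoin k s = ⊤)
    (h : ∀ a ∈ s, LinearMap.mul' k A ((antiLinear S).rTensor A (Coalgebra.comul a)) =
      algebraMap k A (Coalgebra.counit a)) (a : A) :
    LinearMap.mul' k A ((antiLinear S).rTensor A (Coalgebra.comul a)) =
      algebraMap k A (Coalgebra.counit a) := by
  have ha : a ∈ Algebra.adjoin k s := hs ▸ Algebra.mem_top
  induction ha using Algebra.adjoin_induction with
  | mem a ha => exact h a ha
  | algebraMap r => simp [Algebra.TensorProduct.algebraMap_apply, antiLinear_algebraMap]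
  | add a b _ _ ha hb => simp only [map_add, ha, hb]
  | mul a b _ _ ha hb =>
    -- As `S` reverses products, the factor `x ⊗ y` ends up outside the expression in `u`. For `u =
    -- Coalgebra.comul a` the inside is then the scalar `ε(a)`, which is central and moves out.
    have h₁ : ∀ (u : A ⊗[k] A) (x y : A),
        LinearMap.mul' k A ((antiLinear S).rTensor A (u * x ⊗ₜ y)) =
          antiLinear S x * LinearMap.mul' k A ((antiLinear S).rTensor A u) * y := fun u x y => by
      induction u with
      | zero => simp
      | add u v hu hv => simp only [add_mul, mul_add, map_add, hu, hv]
      | tmul p q => simp [antiLinear_mul, mul_assoc]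
    have h₂ : ∀ t : A ⊗[k] A,
        LinearMap.mul' k A ((antiLinear S).rTensor A (Coalgebra.comul a * t)) =
          algebraMap k A (Coalgebra.counit a) *
            LinearMap.mul' k A ((antiLinear S).rTensor A t) := fun t => by
      induction t with
      | zero => simp
      | add u v hu hv => simp only [mul_add, map_add, hu, hv]
      | tmul p q =>
        rw [h₁, ha, ← Algebra.commutes, mul_assoc]
        simp
    rw [Bialgebra.comul_mul, h₂, hb, Bialgebra.counit_mul, map_mul]

/-- The right antipode axiom for an antihomomorphism can be checked on algebra generators. -/
theorem mul_lTensor_comul_of_adjoin (hs : Algebra.adjoin k s = ⊤)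
    (h : ∀ a ∈ s, LinearMap.mul' k A ((antiLinear S).lTensor A (Coalgebra.comul a)) =
      algebraMap k A (Coalgebra.counit a)) (a : A) :
    LinearMap.mul' k A ((antiLinear S).lTensor A (Coalgebra.comul a)) =
      algebraMap k A (Coalgebra.counit a) := by
  have ha : a ∈ Algebra.adjoin k s := hs ▸ Algebra.mem_top
  induction ha using Algebra.adjoin_induction with
  | mem a ha => exact h a ha
  | algebraMap r =>
    have : antiLinear S 1 = 1 := by simpa using antiLinear_algebraMap S 1
    simp [Algebra.TensorProduct.algebraMap_apply, this]
  | add a b _ _ ha hb => simp only [map_add, ha, hb]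
  | mul a b _ _ ha hb =>
    -- Mirror image: here the part coming from `b` is enclosed and collapses to the scalar `ε(b)`.
    have h₁ : ∀ (u : A ⊗[k] A) (x y : A),
        LinearMap.mul' k A ((antiLinear S).lTensor A (x ⊗ₜ y * u)) =
          x * LinearMap.mul' k A ((antiLinear S).lTensor A u) * antiLinear S y := fun u x y => by
      induction u with
      | zero => simp
      | add u v hu hv => simp only [add_mul, mul_add, map_add, hu, hv]
      | tmul p q => simp [antiLinear_mul, mul_assoc]
    have h₂ : ∀ t : A ⊗[k] A,
        LinearMap.mul' k A ((antiLinear S).lTensor A (t * Coalgebra.comul b)) =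
          LinearMap.mul' k A ((antiLinear S).lTensor A t) *
            algebraMap k A (Coalgebra.counit b) := fun t => by
      induction t with
      | zero => simp
      | add u v hu hv => simp only [add_mul, map_add, hu, hv]
      | tmul p q =>
        rw [h₁, hb, mul_assoc, Algebra.commutes, ← mul_assoc]
        simp
    rw [Bialgebra.comul_mul, h₂, ha, Bialgebra.counit_mul, map_mul]

end Antipode

/-! ### Iterated antipodes of a comatrix as iterated inverse matrices. -/

section IteratedInverse

variable {n : ℕ}

/-- A sequence of square matrices each of which is the transpose of the inverse of its
predecessor. -/
structure IsInverseSeq {A : Type*} [Semiring A] (c : ℕ → Fin n → Fin n → A) : Prop where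
  mul_succ : ∀ m i i', ∑ j, c m i j * c (m + 1) i' j = if i = i' then 1 else 0
  succ_mul : ∀ m i i', ∑ j, c (m + 1) j i * c m j i' = if i = i' then 1 else 0

theorem IsInverseSeq.map {A B F : Type*} [Semiring A] [Semiring B] [FunLike F A B]
    [RingHomClass F A B] {c : ℕ → Fin n → Fin n → A} (hc : IsInverseSeq c) (f : F) :
    IsInverseSeq fun m i j => f (c m i j) where
  mul_succ m i i' := by
    simp only [← map_mul, ← map_sum, hc.mul_succ]
    split_ifs <;> simp
  succ_mul m i i' := by
    simp only [← map_mul, ← map_sum, hc.succ_mul]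
    split_ifs <;> simp

/-- Two-sided inverses are unique, so each matrix determines the next. This makes the zeroth matrix
of generators of `ComatrixHopf` enough to determine a morphism. -/
theorem IsInverseSeq.ext {A : Type*} [Semiring A] {c c' : ℕ → Fin n → Fin n → A}
    (hc : IsInverseSeq c) (hc' : IsInverseSeq c') (h : c 0 = c' 0) : c = c' := by
  funext m
  induction m with
  | zero => exact h
  | succ m ih =>
    have h₁ : (Matrix.of (c (m + 1))).transpose * Matrix.of (c m) = 1 := by
      ext i j
      simp [Matrix.mul_apply, hc.succ_mul, Matrix.one_apply]
    have h₂ : Matrix.of (c m) * (Matrix.of (c' (m + 1))).transpose = 1 := by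
      ext i j
      simp [Matrix.mul_apply, ih, hc'.mul_succ, Matrix.one_apply]
    exact Matrix.of.injective (Matrix.transpose_injective (left_inv_eq_right_inv h₁ h₂))

variable {k : Type*} [Field k] {B : Type*} [Ring B] [HopfAlgebra k B]

open HopfAlgebra

theorem IsComatrix.sum_mul_antipode {c : Fin n → Fin n → B} (hc : IsComatrix k c) (i j : Fin n) :
    ∑ l, c i l * antipode k (c l j) = if i = j then 1 else 0 := by
  have := mul_antipode_lTensor_comul_apply (R := k) (c i j)
  rw [hc.comul, hc.counit] at this
  simpa using this

theorem IsComatrix.sum_antipode_mul {c : Fin n → Fin n → B} (hc : IsComatrix k c) (i j : Fin n) :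
    ∑ l, antipode k (c i l) * c l j = if i = j then 1 else 0 := by
  have := mul_antipode_rTensor_comul_apply (R := k) (c i j)
  rw [hc.comul, hc.counit] at this
  simpa using this

/-- Write X for the matrix `c`, Y = S(X) for its inverse, and subscripts 1, 2 for the two embeddings
of `B` in `B ⊗ B`. Then Δ(X) = X₁X₂ has left inverse Δ(Y) and right inverse Y₂Y₁, so these coincide;
the reversed order accounts for the transposition. -/
theorem IsComatrix.antipode {c : Fin n → Fin n → B} (hc : IsComatrix k c) :
    IsComatrix k fun i j => antipode k (c j i) where
  counit i j := by simp [hc.counit, eq_comm]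
  comul i j := by
    let X : Matrix (Fin n) (Fin n) B := Matrix.of c
    let Y : Matrix (Fin n) (Fin n) B := Matrix.of fun i j => HopfAlgebra.antipode k (c i j)
    have hXY : X * Y = 1 := by
      ext i j
      simp [X, Y, Matrix.mul_apply, hc.sum_mul_antipode, Matrix.one_apply]
    have hYX : Y * X = 1 := by
      ext i j
      simp [X, Y, Matrix.mul_apply, hc.sum_antipode_mul, Matrix.one_apply]
    let l : B →ₐ[k] B ⊗[k] B := Algebra.TensorProduct.includeLeft
    let r : B →ₐ[k] B ⊗[k] B := Algebra.TensorProduct.includeRight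
    let d : B →ₐ[k] B ⊗[k] B := Bialgebra.comulAlgHom k B
    have hd : d.mapMatrix X = l.mapMatrix X * r.mapMatrix X := by
      ext i j
      simp [X, l, r, d, Matrix.mul_apply, hc.comul]
    have h₁ : d.mapMatrix Y * d.mapMatrix X = 1 := by rw [← map_mul, hYX, map_one]
    have h₂ : d.mapMatrix X * (r.mapMatrix Y * l.mapMatrix Y) = 1 := by
      rw [hd, mul_assoc, ← mul_assoc (r.mapMatrix X), ← map_mul, hXY, map_one, one_mul, ← map_mul,
        hXY, map_one]
    have h := congrArg (fun M => M j i) (left_inv_eq_right_inv h₁ h₂)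
    simpa [X, Y, l, r, d, Matrix.mul_apply] using h

/-- The comatrices obtained from `c` by iterating the antipode and transposition. -/
noncomputable def antipodeSeq (k : Type*) [Field k] {B : Type*} [Ring B] [HopfAlgebra k B]
    (c : Fin n → Fin n → B) : ℕ → Fin n → Fin n → B
  | 0 => c
  | m + 1 => fun i j => HopfAlgebra.antipode k (antipodeSeq k c m j i)

theorem IsComatrix.antipodeSeq {c : Fin n → Fin n → B} (hc : IsComatrix k c) (m : ℕ) :
    IsComatrix k (antipodeSeq k c m) := by
  induction m with
  | zero => exact hc
  | succ m ih => exact ih.antipode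

theorem IsComatrix.isInverseSeq {c : Fin n → Fin n → B} (hc : IsComatrix k c) :
    IsInverseSeq (_root_.antipodeSeq k c) where
  mul_succ m := (hc.antipodeSeq m).sum_mul_antipode
  succ_mul m := (hc.antipodeSeq m).sum_antipode_mul

end IteratedInverse

/-! ### Construction and universal property of the free Hopf algebra on a comatrix. -/

section FreeHopf

variable (k : Type u) [Field k] (n : ℕ)

/-- The relations that make the generic matrices an inverse sequence. -/
inductive ComatrixHopfRel : FreeAlgebra k (ℕ × Fin n × Fin n) →
    FreeAlgebra k (ℕ × Fin n × Fin n) → Prop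
  | mul_succ (m i i') : ComatrixHopfRel
      (∑ j, FreeAlgebra.ι k (m, i, j) * FreeAlgebra.ι k (m + 1, i', j)) (if i = i' then 1 else 0)
  | succ_mul (m i i') : ComatrixHopfRel
      (∑ j, FreeAlgebra.ι k (m + 1, j, i) * FreeAlgebra.ι k (m, j, i')) (if i = i' then 1 else 0)

/-- The algebra generated by the entries of a generic inverse sequence of matrices. -/
def ComatrixHopf : Type u := RingQuot (ComatrixHopfRel k n)

namespace ComatrixHopf

noncomputable instance : Ring (ComatrixHopf k n) :=
  inferInstanceAs (Ring (RingQuot (ComatrixHopfRel k n)))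

noncomputable instance : Algebra k (ComatrixHopf k n) :=
  inferInstanceAs (Algebra k (RingQuot (ComatrixHopfRel k n)))

/-- The quotient map from the free algebra. -/
noncomputable def mk : FreeAlgebra k (ℕ × Fin n × Fin n) →ₐ[k] ComatrixHopf k n :=
  RingQuot.mkAlgHom k (ComatrixHopfRel k n)

/-- The generators. -/
noncomputable def gen (m : ℕ) (i j : Fin n) : ComatrixHopf k n :=
  mk k n (FreeAlgebra.ι k (m, i, j))

variable {k n}

theorem isInverseSeq_gen : IsInverseSeq (gen k n) where
  mul_succ m i i' := by
    have : mk k n _ = mk k n _ := RingQuot.mkAlgHom_rel k (ComatrixHopfRel.mul_succ m i i')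
    rw [map_sum] at this
    simp only [map_mul] at this
    refine this.trans ?_
    split_ifs <;> simp
  succ_mul m i i' := by
    have : mk k n _ = mk k n _ := RingQuot.mkAlgHom_rel k (ComatrixHopfRel.succ_mul m i i')
    rw [map_sum] at this
    simp only [map_mul] at this
    refine this.trans ?_
    split_ifs <;> simp

theorem adjoin_gen : Algebra.adjoin k {a | ∃ m i j, a = gen k n m i j} = ⊤ := by
  rw [eq_top_iff, ← (AlgHom.range_eq_top (mk k n)).2 (RingQuot.mkAlgHom_surjective k _),
    ← Algebra.map_top, ← FreeAlgebra.adjoin_range_ι, AlgHom.map_adjoin]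
  refine Algebra.adjoin_mono ?_
  rintro _ ⟨_, ⟨⟨m, i, j⟩, rfl⟩, rfl⟩
  exact ⟨m, i, j, rfl⟩

section Lift

variable {A : Type*} [Semiring A] [Algebra k A]

/-- The algebra morphism given by an inverse sequence of matrices. -/
noncomputable def liftAlgHom {c : ℕ → Fin n → Fin n → A} (hc : IsInverseSeq c) :
    ComatrixHopf k n →ₐ[k] A :=
  RingQuot.liftAlgHom k ⟨FreeAlgebra.lift k fun p => c p.1 p.2.1 p.2.2, by
    rintro _ _ (⟨m, i, i'⟩ | ⟨m, i, i'⟩)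
    · simp only [map_sum, map_mul, FreeAlgebra.lift_ι_apply, hc.mul_succ]
      split_ifs <;> simp
    · simp only [map_sum, map_mul, FreeAlgebra.lift_ι_apply, hc.succ_mul]
      split_ifs <;> simp⟩

@[simp]
theorem liftAlgHom_gen {c : ℕ → Fin n → Fin n → A} (hc : IsInverseSeq c) (m : ℕ) (i j : Fin n) :
    liftAlgHom (k := k) hc (gen k n m i j) = c m i j :=
  (RingQuot.liftAlgHom_mkAlgHom_apply k _ _ _).trans (FreeAlgebra.lift_ι_apply _ _)

theorem algHom_ext {f g : ComatrixHopf k n →ₐ[k] A}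
    (h : ∀ m i j, f (gen k n m i j) = g (gen k n m i j)) : f = g :=
  RingQuot.ringQuot_ext' k f g (FreeAlgebra.hom_ext (funext fun p => h p.1 p.2.1 p.2.2))

theorem algHom_ext_zero {f g : ComatrixHopf k n →ₐ[k] A}
    (h : ∀ i j, f (gen k n 0 i j) = g (gen k n 0 i j)) : f = g :=
  algHom_ext fun m i j => congrFun (congrFun₂ (IsInverseSeq.ext (isInverseSeq_gen.map f)
    (isInverseSeq_gen.map g) (funext₂ h)) m i) j

end Lift

/-- These matrices are products of the images of `gen k n m` under the two embeddings. In each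
relation the sum over `j` first collapses one tensor factor to a Kronecker delta, which then lets
the other collapse. Hence the comultiplication respects the relations. -/
theorem isInverseSeq_comul :
    IsInverseSeq fun m i j => ∑ l, gen k n m i l ⊗ₜ[k] gen k n m l j where
  mul_succ m i i' := by
    simp only [Finset.sum_mul_sum, Algebra.TensorProduct.tmul_mul_tmul]
    rw [Finset.sum_comm]
    refine (Finset.sum_congr rfl fun l _ => Finset.sum_comm).trans ?_
    simp only [← TensorProduct.tmul_sum, isInverseSeq_gen.mul_succ, TensorProduct.tmul_ite,
      Finset.sum_ite_eq, Finset.mem_univ, if_true]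
    rw [← TensorProduct.sum_tmul, isInverseSeq_gen.mul_succ, TensorProduct.ite_tmul,
      Algebra.TensorProduct.one_def]
  succ_mul m i i' := by
    simp only [Finset.sum_mul_sum, Algebra.TensorProduct.tmul_mul_tmul]
    rw [Finset.sum_comm]
    refine (Finset.sum_congr rfl fun l _ => Finset.sum_comm).trans ?_
    simp only [← TensorProduct.sum_tmul, isInverseSeq_gen.succ_mul, TensorProduct.ite_tmul,
      Finset.sum_ite_eq, Finset.mem_univ, if_true]
    rw [← TensorProduct.tmul_sum, isInverseSeq_gen.succ_mul, TensorProduct.tmul_ite,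
      Algebra.TensorProduct.one_def]

theorem isInverseSeq_counit :
    IsInverseSeq fun (_ : ℕ) (i j : Fin n) => if i = j then (1 : k) else 0 where
  mul_succ m i i' := by simp
  succ_mul m i i' := by
    rw [if_congr (eq_comm (a := i) (b := i')) rfl rfl]
    simp

noncomputable instance : Bialgebra k (ComatrixHopf k n) :=
  .ofAlgHom (liftAlgHom isInverseSeq_comul) (liftAlgHom isInverseSeq_counit)
    (algHom_ext fun m i j => by
      simp only [AlgHom.comp_apply, liftAlgHom_gen, map_sum, Algebra.TensorProduct.map_tmul,
        TensorProduct.sum_tmul, TensorProduct.tmul_sum, AlgHom.id_apply]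
      simpa using Finset.sum_comm)
    (algHom_ext fun m i j => by simp [TensorProduct.ite_tmul])
    (algHom_ext fun m i j => by simp [TensorProduct.tmul_ite])

theorem isComatrix_gen (m : ℕ) : IsComatrix k (gen k n m) :=
  ⟨liftAlgHom_gen _ m, liftAlgHom_gen _ m⟩

/-- The antipode is to shift the index and transpose. Passing to the opposite algebra exchanges the
two kinds of relations, at index `m + 1` instead of `m`. -/
theorem isInverseSeq_antipode :
    IsInverseSeq fun m i j => MulOpposite.op (gen k n (m + 1) j i) where
  mul_succ m i i' := by
    simp only [← MulOpposite.op_mul, ← Finset.op_sum, isInverseSeq_gen.succ_mul (m + 1),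
      eq_comm (a := i)]
    split_ifs <;> rfl
  succ_mul m i i' := by
    simp only [← MulOpposite.op_mul, ← Finset.op_sum, isInverseSeq_gen.mul_succ (m + 1),
      eq_comm (a := i)]
    split_ifs <;> rfl

theorem antiLinear_gen (m : ℕ) (i j : Fin n) :
    antiLinear (liftAlgHom (k := k) isInverseSeq_antipode) (gen k n m i j) =
      gen k n (m + 1) j i := by
  simp [antiLinear]

/-- On generators, the two antipode axioms are exactly the two families of defining relations. -/
noncomputable instance : HopfAlgebra k (ComatrixHopf k n) where
  antipode := antiLinear (liftAlgHom isInverseSeq_antipode)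
  mul_antipode_rTensor_comul := LinearMap.ext <| mul_rTensor_comul_of_adjoin adjoin_gen <| by
    rintro _ ⟨m, i, j, rfl⟩
    rw [(isComatrix_gen m).comul, (isComatrix_gen m).counit]
    simp [antiLinear_gen, isInverseSeq_gen.succ_mul]
  mul_antipode_lTensor_comul := LinearMap.ext <| mul_lTensor_comul_of_adjoin adjoin_gen <| by
    rintro _ ⟨m, i, j, rfl⟩
    rw [(isComatrix_gen m).comul, (isComatrix_gen m).counit]
    simp [antiLinear_gen, isInverseSeq_gen.mul_succ]

/-- The morphism to a Hopf algebra that corresponds to a comatrix. -/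
noncomputable def lift {B : Type*} [Ring B] [HopfAlgebra k B] {c : Fin n → Fin n → B}
    (hc : IsComatrix k c) : ComatrixHopf k n →ₐc[k] B :=
  .ofAlgHom (liftAlgHom hc.isInverseSeq)
    (algHom_ext fun m i j => by simp [(hc.antipodeSeq m).counit, (isComatrix_gen m).counit])
    (algHom_ext fun m i j => by simp [(hc.antipodeSeq m).comul, (isComatrix_gen m).comul])

theorem lift_gen {B : Type*} [Ring B] [HopfAlgebra k B] {c : Fin n → Fin n → B}
    (hc : IsComatrix k c) (i j : Fin n) : lift hc (gen k n 0 i j) = c i j :=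
  liftAlgHom_gen _ _ _ _

end ComatrixHopf

theorem HopfAlgCat.liftsComatrices {k : Type u} [Field k] {I : Type w} {H : I → HopfAlgCat.{u} k}
    (P : Fan H) (hP : IsLimit P) :
    LiftsComatrices fun i => ((hopfToCoalg k).map (P.proj i)).toCoalgHom :=
  liftsComatrices_of_isLimit (hopfToCoalg k) (fun n =>
    ⟨HopfAlgCat.of k (ComatrixHopf k n), ComatrixHopf.gen k n 0, ComatrixHopf.isComatrix_gen 0,
    fun B _ hc => ⟨HopfAlgCat.ofHom (ComatrixHopf.lift (B := B) hc),
      ComatrixHopf.lift_gen (B := B) hc,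
      fun _ hg => HopfAlgCat.hom_ext _ _ (BialgHom.coe_toAlgHom_injective
        (ComatrixHopf.algHom_ext_zero fun i j =>
          (hg i j).trans (ComatrixHopf.lift_gen (B := B) hc i j).symm))⟩⟩) P hP

end FreeHopf

/-! ### Comodules over a product -/

namespace PseudoPullback

variable {I : Type w} {A : I → Type u₁} [∀ i, Category.{v₁} (A i)]
  {B : Type u₂} [Category.{v₂} B] {F : ∀ i, A i ⥤ B}

/-- An isomorphism of the pseudo-pullback from isomorphisms of the components. -/
def isoMk {X Y : PseudoPullback F} (e : ∀ i, X.obj i ≅ Y.obj i) (e₀ : X.base ≅ Y.base)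
    (h : ∀ i, (F i).map (e i).hom ≫ (Y.iso i).hom = (X.iso i).hom ≫ e₀.hom) : X ≅ Y where
  hom := { app := fun i => (e i).hom, baseMap := e₀.hom, w := h }
  inv :=
    { app := fun i => (e i).inv
      baseMap := e₀.inv
      w := fun i => by
        rw [Iso.eq_comp_inv, Category.assoc, ← h, ← Functor.map_comp_assoc]
        simp }
  hom_inv_id := Hom.ext (funext fun i => (e i).hom_inv_id) e₀.hom_inv_id
  inv_hom_id := Hom.ext (funext fun i => (e i).inv_hom_id) e₀.inv_hom_id

end PseudoPullback

namespace ComodCat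

variable {k : Type u} [Field k]

theorem isCoaction {C : CoalgCat.{u} k} (V : ComodCat C) : IsCoaction V.coact :=
  ⟨LinearMap.congr_fun V.coassoc, LinearMap.congr_fun V.counit_coact⟩

/-- The comodule given by a coaction. -/
def ofCoaction {C : CoalgCat.{u} k} (V : ModuleCat.{u} k) {ρ : V →ₗ[k] V ⊗[k] C}
    (hρ : IsCoaction ρ) : ComodCat C where
  toModuleCat := V
  coact := ρ
  coassoc := LinearMap.ext hρ.coassoc
  counit_coact := LinearMap.ext hρ.counit

/-- An isomorphism of comodules from a bijective comodule morphism. -/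
def isoMk {C : CoalgCat.{u} k} {V W : ComodCat C} (e : V.carrier ≃ₗ[k] W.carrier)
    (h : ∀ x, W.coact (e x) = e.toLinearMap.rTensor C (V.coact x)) : V ≅ W where
  hom := { toLin := e.toLinearMap, comm := LinearMap.ext h }
  inv :=
    { toLin := e.symm.toLinearMap
      comm := LinearMap.ext fun x => by
        obtain ⟨x, rfl⟩ := e.surjective x
        simp only [LinearMap.comp_apply, LinearEquiv.coe_coe, h, LinearEquiv.symm_apply_apply]
        rw [← LinearMap.rTensor_comp_apply]
        simp }
  hom_inv_id := Hom.ext (LinearMap.ext e.symm_apply_apply)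
  inv_hom_id := Hom.ext (LinearMap.ext e.apply_symm_apply)

variable {I : Type w} {C : CoalgCat.{u} k} {D : I → CoalgCat.{u} k} {π : ∀ i, C ⟶ D i}

theorem isLocallyFinite_comparison (V : ComodCat C) :
    isLocallyFinite D ((comparison π).obj V) := by
  -- The filtration consists of all finite-dimensional `C`-subcomodules; they remain subcomodules
  -- after corestriction to each `D i`.
  refine ⟨{W | Module.Finite k W ∧ StableUnder V.coact W}, ?_, fun x => ?_, ?_⟩
  · rintro W ⟨_, hW⟩ W' ⟨_, hW'⟩
    exact ⟨W ⊔ W', ⟨inferInstanceAs (Module.Finite k ↥(W ⊔ W')), hW.sup hW'⟩,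
      le_sup_left, le_sup_right⟩
  · obtain ⟨W, h₁, h₂, h₃⟩ := V.isCoaction.exists_finite_stableUnder x
    exact ⟨W, ⟨h₁, h₂⟩, h₃⟩
  · rintro W ⟨h₁, h₂⟩
    exact ⟨h₁, fun i => h₂.lTensor _⟩

/-- The comodule morphism underlying a morphism between values of the comparison functor. -/
theorem exists_hom_of_corestrict (hπ : LiftsComatrices fun i => (π i).toCoalgHom)
    {V W : ComodCat C} (f : V.carrier →ₗ[k] W.carrier)
    (g : ∀ i, corestrictObj (π i) V ⟶ corestrictObj (π i) W) (hg : ∀ i, (g i).toLin = f) :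
    ∃ f' : V ⟶ W, f'.toLin = f :=
  ⟨{ toLin := f
     comm := LinearMap.ext <| hπ.comm V.isCoaction W.isCoaction f fun i x => by
      have := LinearMap.congr_fun (g i).comm x
      rw [hg i] at this
      exact this }, rfl⟩

/-- The structure isomorphisms are identities here, so the compatibility square forces all
components to have one underlying linear map. -/
theorem hom_app_toLin {V W : ComodCat C} (f : (comparison π).obj V ⟶ (comparison π).obj W)
    (i : I) : (f.app i).toLin = f.baseMap.hom :=
  congrArg ModuleCat.Hom.hom (((Category.comp_id _).symm.trans (f.w i)).trans (Category.id_comp _))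

instance faithful_comparison : (comparison π).Faithful where
  map_injective h := Hom.ext (congrArg ModuleCat.Hom.hom (congrArg PseudoPullback.Hom.baseMap h))

theorem full_comparison (hπ : LiftsComatrices fun i => (π i).toCoalgHom) :
    (comparison π).Full where
  map_surjective f := by
    obtain ⟨f', hf'⟩ := exists_hom_of_corestrict hπ f.baseMap.hom f.app (hom_app_toLin f)
    exact ⟨f', PseudoPullback.Hom.ext (funext fun i => Hom.ext (hf'.trans (hom_app_toLin f i).symm))
      (ModuleCat.hom_ext hf')⟩

/-- The linear equivalence between a component and the base of an object of the
pseudo-pullback. -/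
def baseEquiv (X : PseudoPullback fun i => fgt (D i)) (i : I) :
    (X.obj i).carrier ≃ₗ[k] X.base :=
  (X.iso i).toLinearEquiv

/-- The coactions on the base of an object of the pseudo-pullback. -/
def baseCoact (X : PseudoPullback fun i => fgt (D i)) (i : I) : X.base →ₗ[k] X.base ⊗[k] D i :=
  (baseEquiv X i).toLinearMap.rTensor (D i) ∘ₗ (X.obj i).coact ∘ₗ
    (baseEquiv X i).symm.toLinearMap

theorem isCoaction_baseCoact (X : PseudoPullback fun i => fgt (D i)) (i : I) :
    IsCoaction (baseCoact X i) :=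
  (X.obj i).isCoaction.conj (baseEquiv X i)

theorem baseCoact_baseEquiv (X : PseudoPullback fun i => fgt (D i)) (i : I)
    (x : (X.obj i).carrier) : baseCoact X i (baseEquiv X i x) =
      (baseEquiv X i).toLinearMap.rTensor (D i) ((X.obj i).coact x) := by
  simp only [baseCoact, LinearMap.comp_apply, LinearEquiv.coe_coe, LinearEquiv.symm_apply_apply]

theorem stableUnder_baseCoact {X : PseudoPullback fun i => fgt (D i)} {i : I}
    {W : Submodule k X.base} (h : (X.obj i).IsSubcomodule (W.comap (X.iso i).hom.hom)) :
    StableUnder (baseCoact X i) W := by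
  intro x hx
  obtain ⟨x, rfl⟩ := (baseEquiv X i).surjective x
  rw [baseCoact_baseEquiv]
  let W' : Submodule k (X.obj i).carrier := W.comap (baseEquiv X i).toLinearMap
  obtain ⟨t, ht⟩ : (X.obj i).coact x ∈ LinearMap.range (W'.subtype.rTensor (D i)) := h x hx
  let g : W' →ₗ[k] W := (baseEquiv X i).toLinearMap.restrict fun _ hx => hx
  have hg : W.subtype ∘ₗ g = (baseEquiv X i).toLinearMap ∘ₗ W'.subtype := rfl
  refine ⟨g.rTensor (D i) t, ?_⟩
  rw [← ht, ← LinearMap.rTensor_comp_apply, ← LinearMap.rTensor_comp_apply, hg]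

/-- The components of an object of the pseudo-pullback are corestrictions of any comodule that
induces the coactions on the base. -/
def corestrictIso (X : PseudoPullback fun i => fgt (D i)) {ρ : X.base →ₗ[k] X.base ⊗[k] C}
    (hρ : IsCoaction ρ) (h : ∀ i, ((π i).toCoalgHom : C →ₗ[k] D i).lTensor X.base ∘ₗ ρ =
      baseCoact X i) (i : I) : X.obj i ≅ corestrictObj (π i) (ofCoaction X.base hρ) :=
  isoMk (W := corestrictObj (π i) (ofCoaction X.base hρ)) (baseEquiv X i) fun x =>
    (LinearMap.congr_fun (h i) (baseEquiv X i x)).trans (baseCoact_baseEquiv X i x)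

/-- An object of the pseudo-pullback comes from a comodule that induces the coactions on its
base. -/
def comparisonIso (X : PseudoPullback fun i => fgt (D i)) {ρ : X.base →ₗ[k] X.base ⊗[k] C}
    (hρ : IsCoaction ρ) (h : ∀ i, ((π i).toCoalgHom : C →ₗ[k] D i).lTensor X.base ∘ₗ ρ =
      baseCoact X i) : X ≅ (comparison π).obj (ofCoaction X.base hρ) :=
  PseudoPullback.isoMk (corestrictIso X hρ h) (Iso.refl X.base) fun _ => rfl

theorem realizesLocallyFinitePseudoPullback
    (hπ : LiftsComatrices fun i => (π i).toCoalgHom) :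
    RealizesLocallyFinitePseudoPullback π := by
  refine ⟨isLocallyFinite_comparison, ?_⟩
  have := full_comparison hπ
  have : ((isLocallyFinite D).lift (comparison π) isLocallyFinite_comparison).EssSurj := by
    refine ⟨fun ⟨X, S, hS, hcov, hfin⟩ => ?_⟩
    obtain ⟨ρ, hρ, h⟩ := hπ.exists_coaction_of_directedOn (isCoaction_baseCoact X) hS hcov
      (fun W hW => (hfin W hW).1) fun W hW i => stableUnder_baseCoact ((hfin W hW).2 i)
    exact ⟨ofCoaction X.base hρ, ⟨(isLocallyFinite D).isoMk (comparisonIso X hρ h).symm⟩⟩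
  -- Faithfulness and fullness of the lift are inherited from `comparison π` by instance resolution.
  exact {}

/-- The object of the pseudo-pullback underlying an object of its finite-dimensional version. -/
def ofFD (X : PseudoPullback fun i => fgtFD (D i)) : PseudoPullback fun i => fgt (D i) where
  obj i := (X.obj i).obj
  base := X.base.obj
  iso i := (ModuleCat.isFG k).ι.mapIso (X.iso i)

theorem homFD_app_toLin {V W : (isFD C).FullSubcategory}
    (f : (comparisonFD π).obj V ⟶ (comparisonFD π).obj W) (i : I) :
    (f.app i).hom.toLin = f.baseMap.hom.hom :=
  congrArg (fun g => g.hom.hom)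
    (((Category.comp_id _).symm.trans (f.w i)).trans (Category.id_comp _))

/-- No filtration is needed: the base is finite-dimensional, so `LiftsComatrices.exists_coaction`
applies to it directly. -/
theorem realizesPseudoPullbackFD (hπ : LiftsComatrices fun i => (π i).toCoalgHom) :
    RealizesPseudoPullbackFD π where
  faithful := ⟨fun h => ObjectProperty.hom_ext _
    (Hom.ext (congrArg (fun g => g.baseMap.hom.hom) h))⟩
  full := ⟨fun {V W} f => by
    obtain ⟨f', hf'⟩ := exists_hom_of_corestrict (V := V.obj) (W := W.obj) hπ f.baseMap.hom.hom
      (fun i => (f.app i).hom) (homFD_app_toLin f)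
    exact ⟨ObjectProperty.homMk f', PseudoPullback.Hom.ext
      (funext fun i => ObjectProperty.hom_ext _ (Hom.ext (hf'.trans (homFD_app_toLin f i).symm)))
      (ObjectProperty.hom_ext _ (ModuleCat.hom_ext hf'))⟩⟩
  essSurj := ⟨fun X => by
    have : Module.Finite k (ofFD X).base := X.base.property
    obtain ⟨ρ, hρ, h⟩ := hπ.exists_coaction (isCoaction_baseCoact (ofFD X))
    let V : (isFD C).FullSubcategory := ⟨ofCoaction (ofFD X).base hρ, X.base.property⟩
    exact ⟨V, ⟨(PseudoPullback.isoMk (Y := (comparisonFD π).obj V)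
      (fun i => (isFD (D i)).isoMk (corestrictIso (ofFD X) hρ h i)) (Iso.refl X.base)
        fun _ => rfl).symm⟩⟩⟩

end ComodCat

theorem mainTheorem8 {k : Type u} [Field k] {I : Type w} :
    (∀ (C : I → CoalgCat.{u} k) (P : Fan C), IsLimit P →
      ComodCat.RealizesLocallyFinitePseudoPullback P.proj ∧ ComodCat.RealizesPseudoPullbackFD P.proj) ∧
    (∀ (H : I → BialgCat.{u} k) (P : Fan H), IsLimit P →
      ComodCat.RealizesLocallyFinitePseudoPullback
          (fun i => (forget₂ (BialgCat.{u} k) (CoalgCat.{u} k)).map (P.proj i)) ∧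
        ComodCat.RealizesPseudoPullbackFD
          (fun i => (forget₂ (BialgCat.{u} k) (CoalgCat.{u} k)).map (P.proj i))) ∧
    (∀ (H : I → HopfAlgCat.{u} k) (P : Fan H), IsLimit P →
      ComodCat.RealizesLocallyFinitePseudoPullback (fun i => (hopfToCoalg k).map (P.proj i)) ∧
        ComodCat.RealizesPseudoPullbackFD (fun i => (hopfToCoalg k).map (P.proj i))) :=
  ⟨fun _ P hP => ⟨ComodCat.realizesLocallyFinitePseudoPullback (CoalgCat.liftsComatrices P hP),
      ComodCat.realizesPseudoPullbackFD (CoalgCat.liftsComatrices P hP)⟩,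
    fun _ P hP => ⟨ComodCat.realizesLocallyFinitePseudoPullback (BialgCat.liftsComatrices P hP),
      ComodCat.realizesPseudoPullbackFD (BialgCat.liftsComatrices P hP)⟩,
    fun _ P hP => ⟨ComodCat.realizesLocallyFinitePseudoPullback (HopfAlgCat.liftsComatrices P hP),
      ComodCat.realizesPseudoPullbackFD (HopfAlgCat.liftsComatrices P hP)⟩⟩
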